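/- Let $\Bbbk$ be a field, $d\ge 1$, and let $n_1,\dots,n_d$ be positive integers with $n_1<n_i$ for all $i=2,\dots,d$ which form a minimal system of generators of the semigroup $S=\langle n_1,\dots,n_d\rangle\subseteq\mathbb N$ (with $0\in S$; $S$ is a numerical semigroup if $\gcd(n_1,\dots,n_d)=1$, but this is not needed). Notation. For $a\in\mathbb N^d$ put $x^a=x_1^{a_1}\cdots x_d^{a_d}$, $|a|=\sum_i a_i$ and $s(a)=\sum_i a_in_i$; $a$ is a factorization of $s(a)$, of length $|a|$, and it is called maximal if no factorization of $s(a)$ has larger length. Let $\bar a=a$ if $a_1=0$ and $\bar a=(a_1-1,a_2,\dots,a_d)$ if $a_1>0$. Let $\mathrm{Ap}(S,n_1)=\{x\in S: x-n_1\notin S\}$. $S$ is called homogeneous if for every nonzero element of $\mathrm{Ap}(S,n_1)$ all factorizations have the same length. Let $P=\Bbbk[x_1,\dots,x_d]$, let $I_S$ be the kernel of $P\to\Bbbk[t]$, $x_i\mapsto t^{n_i}$, let $\Bbbk[S]=\Bbbk[t^{n_1},\dots,t^{n_d}]\subseteq\Bbbk[t]$, $\mathfrak m=(t^{n_1},\dots,t^{n_d})\subseteq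 \Bbbk[S]$, and let $G(S)=\bigoplus_{j\ge0}\mathfrak m^j/\mathfrak m^{j+1}$ be the associated graded ring. A binomial is a polynomial $x^a-x^b$. In (3) and (4) below binomials are taken up to sign: the condition concerns every pair $(a,b)$ such that $x^a-x^b$ or $x^b-x^a$ belongs to $E$. A minimal generating set is a generating set no proper subset of which generates. For $0\ne f\in P$ let $f_*$ be its homogeneous summand of least degree; $E\subseteq I_S$ is a standard basis of $I_S$ if $\{f_*: f\in E\}$ generates the ideal $(f_*: 0\neq f\in I_S)$. Let $<_{ds}$ be the negative degree reverse lexicographic order with $x_2>\dots>x_d>x_1$, that is, $x^b<_{ds}x^a$ if and only if $|b|>|a|$; or $|b|=|a|$ and $b_1>a_1$; or $|b|=|a|$, $b_1=a_1$ and there is $2\le i\le d$ with $b_j=a_j$ for all $j>i$ and $b_i>a_i$. The leading monomial $\mathrm{lm}(f)$ of $f\neq0$ is the $<_{ds}$-largest monomial of $f$. A subset $G\subseteq I_S$ is a Gröbner basis of $I_S$ with respect to $<_{ds}$ if $\{\mathrm{lm}(f):0\ne f\in G\}$ generates the ideal $(\mathrm{lm}(f):0\ne f\in I_S)$, and it is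 minimal if no proper subset of $G$ is a Gröbner basis of $I_S$. Theorem. The following statements are equivalent. (1) $S$ is homogeneous and $G(S)$ is Cohen–Macaulay. (2) For all $a,b\in\mathbb N^d$ with $x^a-x^b\in I_S$ and $|a|>|b|$ we have $s(a)\notin\mathrm{Ap}(S,n_1)$; moreover, if $a_1+b_1\ne0$ and $\bar b$ is a maximal factorization (of $s(\bar b)$), then $a_1\ge b_1$. (3) There is a minimal generating set $E$ of $I_S$ consisting of binomials such that for all $x^a-x^b\in E$ (up to sign) with $|a|>|b|$ we have $a_1\ne0$. (4) There is a minimal generating set $E$ of $I_S$ consisting of binomials which is a standard basis of $I_S$ and such that for all $x^a-x^b\in E$ (up to sign) with $|a|>|b|$ we have $a_1\neq0$. (5) There is a minimal Gröbner basis $G$ of $I_S$ with respect to $<_{ds}$, consisting of binomials, such that the variable $x_1$ occurs in every non-homogeneous element of $G$, and $x_1$ does not divide $\mathrm{lm}(f)$ for any $f\in G$. -/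

import Mathlib

/-!
Throughout, a sequence of `d + 1` generators is `n : Fin (d + 1) → ℕ`. The distinguished (smallest)
generator is `n 0`, and the distinguished variable is `X 0`; the remaining variables keep their
order. Exponent vectors are finitely supported functions `Fin (d + 1) →₀ ℕ`, and the length of an
exponent vector `a` (the sum of its entries) is `a.degree`.
-/

noncomputable section

namespace NumSgp

open MvPolynomial

/-! ### The semigroup, factorizations, Apery sets -/

section Semigroup

variable {d : ℕ}

/-- The semigroup (submonoid of `ℕ`) generated by the `n i`. -/
def semigroup (n : Fin (d + 1) → ℕ) : AddSubmonoid ℕ :=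
  AddSubmonoid.closure (Set.range n)

/-- The family `n` is a minimal system of generators of `semigroup n`: no generator lies in the
semigroup generated by the others. -/
def IsMinimalSystem (n : Fin (d + 1) → ℕ) : Prop :=
  ∀ i, n i ∉ AddSubmonoid.closure (n '' {j | j ≠ i})

/-- The element `∑ a_i n_i` of which `a` is a factorization. -/
def value (n : Fin (d + 1) → ℕ) (a : Fin (d + 1) →₀ ℕ) : ℕ :=
  ∑ i, a i * n i

/-- The set of all factorizations of `s`. -/
def factorizations (n : Fin (d + 1) → ℕ) (s : ℕ) : Set (Fin (d + 1) →₀ ℕ) :=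
  {a | value n a = s}

/-- The set of lengths of `s`. -/
def lengths (n : Fin (d + 1) → ℕ) (s : ℕ) : Set ℕ :=
  Finsupp.degree '' factorizations n s

/-- `a` is a maximal factorization (of the element `value n a`): it has the largest length among
all the factorizations of that element. -/
def IsMaximalFactorization (n : Fin (d + 1) → ℕ) (a : Fin (d + 1) →₀ ℕ) : Prop :=
  IsGreatest (lengths n (value n a)) a.degree

/-- The Apery set of `S` with respect to `s`: the `x ∈ S` with `x - s ∉ S`
(the difference being taken in `ℤ`). -/
def apery (S : AddSubmonoid ℕ) (s : ℕ) : Set ℕ :=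
  {x | x ∈ S ∧ ¬ ∃ y ∈ S, y + s = x}

/-- A set `T` of elements of the semigroup is homogeneous when every nonzero element of `T` has
exactly one length. -/
def IsHomogeneousSet (n : Fin (d + 1) → ℕ) (T : Set ℕ) : Prop :=
  ∀ s ∈ T, s ≠ 0 → ∃ l, lengths n s = {l}

/-- The semigroup generated by `n` is homogeneous when its Apery set with respect to `n 0` is. -/
def IsHomogeneousSemigroup (n : Fin (d + 1) → ℕ) : Prop :=
  IsHomogeneousSet n (apery (semigroup n) (n 0))

/-- `ā`: the vector `a` if `a 0 = 0`, and otherwise `a` with its entry at `0` lowered by one. -/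
def bar (a : Fin (d + 1) →₀ ℕ) : Fin (d + 1) →₀ ℕ :=
  if a 0 = 0 then a else a - Finsupp.single 0 1

end Semigroup

/-! ### Cohen-Macaulay rings and associated graded rings -/

section CohenMacaulay

/-- A (Noetherian) local ring whose depth equals its dimension: there is a regular sequence in the
maximal ideal whose length is the Krull dimension. (A regular sequence is never longer.) -/
def HasFullDepth (A : Type*) [CommRing A] [IsLocalRing A] : Prop :=
  ∃ rs : List A, (∀ r ∈ rs, r ∈ IsLocalRing.maximalIdeal A) ∧
    RingTheory.Sequence.IsRegular A rs ∧ (rs.length : WithBot ℕ∞) = ringKrullDim A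

/-- A Noetherian ring all of whose localizations at maximal ideals have depth equal to their
dimension. -/
def IsCohenMacaulay (A : Type*) [CommRing A] : Prop :=
  IsNoetherianRing A ∧
    ∀ (M : Ideal A) [M.IsMaximal], HasFullDepth (Localization.AtPrime M)

/-- The associated graded ring `⨁ Iʲ / Iʲ⁺¹`, as the quotient `R[It] / I R[It]` of the Rees
algebra. -/
abbrev AssociatedGradedRing {R : Type*} [CommRing R] (I : Ideal R) : Type _ :=
  reesAlgebra I ⧸ I.map (algebraMap R (reesAlgebra I))

end CohenMacaulay

/-! ### The semigroup ring, its defining ideal and its tangent cone -/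

section SemigroupRing

variable (k : Type*) [Field k] {d : ℕ} (n : Fin (d + 1) → ℕ)

/-- The semigroup ring `k[S] = k[t ^ n_i] ⊆ k[t]`. -/
abbrev semigroupRing : Subalgebra k (Polynomial k) :=
  Algebra.adjoin k (Set.range fun i => (Polynomial.X : Polynomial k) ^ n i)

/-- The ideal `(t ^ n_i)` of the semigroup ring. -/
def semigroupRingIdeal : Ideal (semigroupRing k n) :=
  Ideal.span {f | ∃ i, (f : Polynomial k) = Polynomial.X ^ n i}

/-- `G(S)`, the associated graded ring of the semigroup ring with respect to `(t ^ n_i)`. -/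
abbrev TangentCone : Type _ :=
  AssociatedGradedRing (semigroupRingIdeal k n)

/-- The defining ideal `I_S`, the kernel of `k[x] → k[t]`, `x_i ↦ t ^ n_i`. -/
def definingIdeal : Ideal (MvPolynomial (Fin (d + 1)) k) :=
  RingHom.ker (aeval (R := k) fun i => (Polynomial.X : Polynomial k) ^ n i)

end SemigroupRing

/-! ### Binomials, minimal generating sets, standard bases, Groebner bases -/

section Polynomials

variable {k : Type*} [Field k] {d : ℕ}

/-- The binomial `x ^ a - x ^ b`. -/
def binomial (k : Type*) [Field k] (a b : Fin (d + 1) →₀ ℕ) : MvPolynomial (Fin (d + 1)) k :=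
  monomial a 1 - monomial b 1

/-- `E` is a set of binomials `x ^ a - x ^ b`. -/
def IsBinomialSet (E : Set (MvPolynomial (Fin (d + 1)) k)) : Prop :=
  ∀ f ∈ E, ∃ a b, f = binomial k a b

/-- `E` is a minimal set of generators of `I`: it generates `I` and no proper subset does. -/
def IsMinimalGeneratingSet (I : Ideal (MvPolynomial (Fin (d + 1)) k))
    (E : Set (MvPolynomial (Fin (d + 1)) k)) : Prop :=
  Minimal (fun E' => Ideal.span E' = I) E

/-- The distinguished variable divides the term of larger degree of every non-homogeneous binomial
of `E`. Binomials are taken up to sign. -/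
def FirstVarDividesLongerTerms (E : Set (MvPolynomial (Fin (d + 1)) k)) : Prop :=
  ∀ a b : Fin (d + 1) →₀ ℕ, (binomial k a b ∈ E ∨ binomial k b a ∈ E) →
    b.degree < a.degree → a 0 ≠ 0

/-- The least degree of a monomial of `f`. -/
def leastDegree (f : MvPolynomial (Fin (d + 1)) k) : ℕ :=
  sInf (Finsupp.degree '' (f.support : Set (Fin (d + 1) →₀ ℕ)))

/-- `f_*`, the homogeneous summand of `f` of least degree. -/
def initialForm (f : MvPolynomial (Fin (d + 1)) k) : MvPolynomial (Fin (d + 1)) k :=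
  homogeneousComponent (leastDegree f) f

/-- `I_*`, the ideal generated by all the `f_*` with `f ∈ I`. -/
def initialFormIdeal (I : Ideal (MvPolynomial (Fin (d + 1)) k)) :
    Ideal (MvPolynomial (Fin (d + 1)) k) :=
  Ideal.span (initialForm '' (I : Set (MvPolynomial (Fin (d + 1)) k)))

/-- `E ⊆ I` is a standard basis of `I`: the `f_*` with `f ∈ E` generate `I_*`. -/
def IsStandardBasis (I : Ideal (MvPolynomial (Fin (d + 1)) k))
    (E : Set (MvPolynomial (Fin (d + 1)) k)) : Prop :=
  E ⊆ (I : Set (MvPolynomial (Fin (d + 1)) k)) ∧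
    Ideal.span (initialForm '' E) = initialFormIdeal I

/-- The negative degree reverse lexicographic order, for which the distinguished variable is the
smallest variable: `dsLT b a` means `x ^ b <_ds x ^ a`. -/
def dsLT (b a : Fin (d + 1) →₀ ℕ) : Prop :=
  a.degree < b.degree ∨
  (b.degree = a.degree ∧ a 0 < b 0) ∨
  (b.degree = a.degree ∧ b 0 = a 0 ∧
    ∃ i, i ≠ 0 ∧ (∀ j, i < j → b j = a j) ∧ a i < b i)

/-- `x ^ c` is the leading monomial of `f` with respect to `<_ds`. (It exists, and is unique, if and
only if `f ≠ 0`.) -/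
def IsLeadingExponent (f : MvPolynomial (Fin (d + 1)) k) (c : Fin (d + 1) →₀ ℕ) : Prop :=
  c ∈ f.support ∧ ∀ b ∈ f.support, b ≠ c → dsLT b c

/-- The ideal generated by the leading monomials of the (nonzero) elements of `F`. -/
def leadingMonomialIdeal (F : Set (MvPolynomial (Fin (d + 1)) k)) :
    Ideal (MvPolynomial (Fin (d + 1)) k) :=
  Ideal.span {g | ∃ f ∈ F, ∃ c, IsLeadingExponent f c ∧ g = monomial c 1}

/-- `G ⊆ I` is a Groebner basis of `I` with respect to `<_ds`. -/
def IsGroebnerBasis (I : Ideal (MvPolynomial (Fin (d + 1)) k))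
    (G : Set (MvPolynomial (Fin (d + 1)) k)) : Prop :=
  G ⊆ (I : Set (MvPolynomial (Fin (d + 1)) k)) ∧
    leadingMonomialIdeal G = leadingMonomialIdeal (I : Set (MvPolynomial (Fin (d + 1)) k))

/-- `G` is a Groebner basis of `I` no proper subset of which is a Groebner basis of `I`. -/
def IsMinimalGroebnerBasis (I : Ideal (MvPolynomial (Fin (d + 1)) k))
    (G : Set (MvPolynomial (Fin (d + 1)) k)) : Prop :=
  Minimal (IsGroebnerBasis I) G

end Polynomials

end NumSgp

end

/-!
The theorem is reduced to two conditions on factorizations, `LengthsForceFirst` (an element with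
factorizations of different lengths has one involving the first generator) and
`FirstPreservesMaximality` (if `a` is a factorization of maximal length, then so is `a + e₀`).
That the condition on pairs of factorizations is their conjunction is elementary
(`pair_condition_iff`), and the first of them is homogeneity of the semigroup.

*Cohen-Macaulayness.* The tangent cone has a basis indexed by the elements `s` of the semigroup, the
basis element of `s` lying in degree the maximal length of `s`; a product of variables vanishes in
it exactly when its exponent vector is not maximal. All variables but the first are nilpotent,
because `n 0` copies of `n i` can be traded for `n i > n 0` copies of `n 0`. Hence the cone is
generated by the first variable `x` modulo nilpotents and has dimension at most one. If adding the
first generator preserves maximality, all nonzero polynomials in `x` are nonzerodivisors, and each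
maximal ideal contains such a polynomial, which gives full depth. Otherwise some maximal
factorization stays maximal under the addition of no generator at all; its class is annihilated by
the irrelevant ideal, and the depth there is zero while the dimension is not
(`isCohenMacaulay_tangentCone_iff`).

*Generating sets.* A set of binomials in the defining ideal generates it if and only if any
two factorizations of an element are joined by a chain of moves along its binomials. If the first
variable divides the longer term of each non-homogeneous binomial, then every move that changes the
length has its longer end divisible by the first variable. This forces both conditions
(`lengthsForceFirst_of_connects`, `firstPreservesMaximality_of_connects`), and it also makes the
set a standard basis: modulo the initial forms, chains of moves can be cut at the first change of
length, where either a monomial vanishes or the first variable can be cancelled, and induction on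
the value applies (`isStandardBasis_of_span_eq`).

*Groebner bases.* The leading exponents of the defining ideal are the factorizations that are not
least for the order among those of the same value. Since every element has finitely many
factorizations, division by a Groebner basis of binomials terminates although the order is local,
so such a basis connects all factorizations (`IsGroebnerBasis.connects`) and generates the ideal.
Conversely, as the first variable is the smallest one, the two conditions make the least
factorizations stable under adding `e₀`; this yields the required properties of the basis formed by
the binomials `x ^ a - x ^ r` with `x ^ a` a minimal leading monomial and `r` the least
factorization of its value (`reducedBasis`), and of any minimal generating subset of it.
-/

noncomputable section

namespace NumSgp

open MvPolynomial

/-! ### Values, lengths and maximal factorizations -/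

section Factorizations

variable {d : ℕ} (n : Fin (d + 1) → ℕ)

lemma value_zero : value n 0 = 0 := by simp [value]

lemma value_add (a b : Fin (d + 1) →₀ ℕ) : value n (a + b) = value n a + value n b := by
  simp [value, add_mul, Finset.sum_add_distrib]

lemma value_single (i : Fin (d + 1)) (m : ℕ) : value n (Finsupp.single i m) = m * n i := by
  rw [value, Finset.sum_eq_single i]
  · simp
  · intro j _ hj
    simp [Finsupp.single_eq_of_ne hj]
  · simp

lemma exists_value_eq_of_mem_semigroup {s : ℕ} (hs : s ∈ semigroup n) :
    ∃ a, value n a = s := by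
  induction hs using AddSubmonoid.closure_induction with
  | mem x hx =>
    obtain ⟨i, rfl⟩ := hx
    exact ⟨Finsupp.single i 1, by simp [value_single]⟩
  | zero => exact ⟨0, value_zero n⟩
  | add x y _ _ hx hy =>
    obtain ⟨a, rfl⟩ := hx
    obtain ⟨b, rfl⟩ := hy
    exact ⟨a + b, value_add n a b⟩

lemma value_mem_semigroup (a : Fin (d + 1) →₀ ℕ) : value n a ∈ semigroup n := by
  refine AddSubmonoid.sum_mem _ fun i _ => ?_
  rw [← smul_eq_mul]
  exact AddSubmonoid.nsmul_mem (semigroup n)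
    (AddSubmonoid.subset_closure (Set.mem_range_self i)) _

lemma exists_eq_add_single {a : Fin (d + 1) →₀ ℕ} {i : Fin (d + 1)} (h : a i ≠ 0) :
    ∃ b, a = b + Finsupp.single i 1 :=
  ⟨a - Finsupp.single i 1, (tsub_add_cancel_of_le (by
    rw [Finsupp.single_le_iff]; omega)).symm⟩

lemma degree_add_single (a : Fin (d + 1) →₀ ℕ) (i : Fin (d + 1)) :
    (a + Finsupp.single i 1).degree = a.degree + 1 := by
  rw [map_add, Finsupp.degree_single]

/-- An element of the semigroup lies outside the Apery set exactly when one of its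
factorizations involves the first generator. -/
lemma value_notMem_apery_iff (a : Fin (d + 1) →₀ ℕ) :
    value n a ∉ apery (semigroup n) (n 0) ↔ ∃ c, value n c = value n a ∧ c 0 ≠ 0 := by
  constructor
  · intro h
    simp only [apery, Set.mem_ofPred_eq, not_and, not_not] at h
    obtain ⟨y, hy, hya⟩ := h (value_mem_semigroup n a)
    obtain ⟨c, rfl⟩ := exists_value_eq_of_mem_semigroup n hy
    exact ⟨c + Finsupp.single 0 1, by simp [value_add, value_single, hya], by simp⟩
  · rintro ⟨c, hc, hc0⟩ h
    obtain ⟨b, rfl⟩ := exists_eq_add_single hc0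
    refine h.2 ⟨value n b, value_mem_semigroup n b, ?_⟩
    rw [← hc, value_add, value_single, one_mul]

lemma isMaximalFactorization_iff (a : Fin (d + 1) →₀ ℕ) :
    IsMaximalFactorization n a ↔ ∀ b, value n b = value n a → b.degree ≤ a.degree := by
  constructor
  · intro h b hb
    exact h.2 ⟨b, hb, rfl⟩
  · intro h
    refine ⟨⟨a, rfl, rfl⟩, ?_⟩
    rintro _ ⟨b, hb, rfl⟩
    exact h b hb

lemma IsMaximalFactorization.of_add {a b : Fin (d + 1) →₀ ℕ}
    (h : IsMaximalFactorization n (a + b)) : IsMaximalFactorization n a := by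
  rw [isMaximalFactorization_iff] at h ⊢
  intro c hc
  have := h (c + b) (by rw [value_add, value_add, hc])
  rw [map_add, map_add] at this
  omega

lemma not_isMaximalFactorization_iff (a : Fin (d + 1) →₀ ℕ) :
    ¬ IsMaximalFactorization n a ↔ ∃ b, value n b = value n a ∧ a.degree < b.degree := by
  rw [isMaximalFactorization_iff]
  push Not
  rfl

/-- Every element of the semigroup with factorizations of different lengths has a factorization
involving the first generator. -/
def LengthsForceFirst : Prop :=
  ∀ a b, value n a = value n b → b.degree < a.degree → ∃ c, value n c = value n a ∧ c 0 ≠ 0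

/-- Adding the first generator to a maximal factorization gives a maximal factorization. In the
tangent cone this says that no nonzero monomial is annihilated by the class of the first variable. -/
def FirstPreservesMaximality : Prop :=
  ∀ a, IsMaximalFactorization n a → IsMaximalFactorization n (a + Finsupp.single 0 1)

variable {n}

lemma FirstPreservesMaximality.add_single (hn : FirstPreservesMaximality n)
    {a : Fin (d + 1) →₀ ℕ} (ha : IsMaximalFactorization n a) (m : ℕ) :
    IsMaximalFactorization n (a + Finsupp.single 0 m) := by
  induction m with
  | zero => simpa using ha
  | succ m ih =>
    rw [Finsupp.single_add, ← add_assoc]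
    exact hn _ ih

lemma degree_le_value (hpos : ∀ i, 0 < n i) (a : Fin (d + 1) →₀ ℕ) : a.degree ≤ value n a := by
  rw [Finsupp.degree_eq_sum]
  exact Finset.sum_le_sum fun i _ => Nat.le_mul_of_pos_right _ (hpos i)

lemma finite_factorizations (hpos : ∀ i, 0 < n i) (s : ℕ) : (factorizations n s).Finite := by
  refine (Set.finite_Iic (Finsupp.equivFunOnFinite.symm fun _ : Fin (d + 1) => s)).subset ?_
  intro a ha i
  have h1 := degree_le_value hpos a
  have h2 := Finsupp.le_degree i a
  have h3 : value n a = s := ha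
  simp only [Finsupp.equivFunOnFinite_symm_apply_apply]
  omega

/-- A multiple of the smallest generator has the obvious factorization as a maximal one. -/
lemma isMaximalFactorization_single_zero (hpos : ∀ i, 0 < n i) (hlt : ∀ i, i ≠ 0 → n 0 < n i)
    (m : ℕ) : IsMaximalFactorization n (Finsupp.single 0 m) := by
  rw [isMaximalFactorization_iff]
  intro b hb
  rw [value_single] at hb
  rw [Finsupp.degree_single]
  refine Nat.le_of_mul_le_mul_right ?_ (hpos 0)
  rw [← hb, Finsupp.degree_eq_sum, Finset.sum_mul]
  refine Finset.sum_le_sum fun i _ => Nat.mul_le_mul_left _ ?_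
  rcases eq_or_ne i 0 with rfl | hi
  · exact le_rfl
  · exact (hlt i hi).le

/-- `n 0` copies of another generator `n i` can be traded for `n i` copies of `n 0`. -/
lemma not_isMaximalFactorization_single (hlt : ∀ i, i ≠ 0 → n 0 < n i) {i : Fin (d + 1)}
    (hi : i ≠ 0) : ¬ IsMaximalFactorization n (Finsupp.single i (n 0)) := by
  rw [not_isMaximalFactorization_iff]
  refine ⟨Finsupp.single 0 (n i), ?_, ?_⟩
  · rw [value_single, value_single, mul_comm]
  · rw [Finsupp.degree_single, Finsupp.degree_single]
    exact hlt i hi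

end Factorizations

/-! ### Binomials of the defining ideal -/

section Ideal

variable {k : Type*} [Field k] {d : ℕ} {n : Fin (d + 1) → ℕ}

lemma aeval_monomial_pow (a : Fin (d + 1) →₀ ℕ) (r : k) :
    aeval (R := k) (fun i => (Polynomial.X : Polynomial k) ^ n i) (monomial a r) =
      Polynomial.monomial (value n a) r := by
  rw [aeval_monomial, Finsupp.prod_fintype _ _ (by simp), ← Polynomial.C_mul_X_pow_eq_monomial,
    value]
  simp only [← pow_mul]
  rw [Finset.prod_pow_eq_pow_sum]
  simp only [mul_comm, Polynomial.algebraMap_eq]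

lemma binomial_mem_definingIdeal {a b : Fin (d + 1) →₀ ℕ} :
    binomial k a b ∈ definingIdeal k n ↔ value n a = value n b := by
  rw [definingIdeal, RingHom.mem_ker, binomial, map_sub, aeval_monomial_pow, aeval_monomial_pow,
    sub_eq_zero]
  constructor
  · intro h
    exact (Polynomial.monomial_left_inj one_ne_zero).1 h
  · intro h
    rw [h]

/-- The defining ideal is graded by value: in each value the coefficients add up to zero. -/
lemma sum_coeff_eq_zero {f : MvPolynomial (Fin (d + 1)) k} (hf : f ∈ definingIdeal k n) (s : ℕ) :
    ∑ c ∈ f.support with value n c = s, coeff c f = 0 := by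
  have h : aeval (R := k) (fun i => (Polynomial.X : Polynomial k) ^ n i) f = 0 := hf
  rw [f.as_sum, map_sum] at h
  have h2 := congrArg (fun p => Polynomial.coeff p s) h
  simp only [aeval_monomial_pow, Polynomial.finsetSum_coeff, Polynomial.coeff_monomial,
    Polynomial.coeff_zero] at h2
  rw [Finset.sum_filter]
  exact h2

/-- Membership in an ideal, checked value by value: in each value either all monomials lie in the
ideal, or they are all congruent and the coefficients add up to zero. -/
lemma sum_monomial_mem (n : Fin (d + 1) → ℕ) (J : Ideal (MvPolynomial (Fin (d + 1)) k))
    (T : Finset (Fin (d + 1) →₀ ℕ)) (r : (Fin (d + 1) →₀ ℕ) → k)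
    (h : ∀ s, (∀ c ∈ T, value n c = s → monomial c (1 : k) ∈ J) ∨
      (∑ c ∈ T with value n c = s, r c = 0 ∧
        ∀ c ∈ T, ∀ c' ∈ T, value n c = s → value n c' = s → binomial k c c' ∈ J)) :
    ∑ c ∈ T, monomial c (r c) ∈ J := by
  have hmon : ∀ c, monomial c (r c) = C (r c) * monomial c (1 : k) := fun c => by
    rw [C_mul_monomial, mul_one]
  rw [← Finset.sum_fiberwise_of_maps_to (t := T.image (value n)) (g := value n)
    (fun c hc => Finset.mem_image_of_mem _ hc)]
  refine Ideal.sum_mem _ fun s hs => ?_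
  rcases h s with h | ⟨h0, h⟩
  · refine Ideal.sum_mem _ fun c hc => ?_
    rw [Finset.mem_filter] at hc
    rw [hmon]
    exact J.mul_mem_left _ (h c hc.1 hc.2)
  · obtain ⟨c₀, hc₀, hs₀⟩ := Finset.mem_image.1 hs
    -- subtracting `(∑ r c) x ^ c₀ = 0` turns the sum into a combination of binomials
    have : ∑ c ∈ T with value n c = s, monomial c (r c) =
        ∑ c ∈ T with value n c = s, C (r c) * binomial k c c₀ := by
      simp only [binomial, mul_sub, Finset.sum_sub_distrib, ← hmon, ← Finset.sum_mul, ← map_sum]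
      rw [h0, C_0, zero_mul, sub_zero]
    rw [this]
    refine Ideal.sum_mem _ fun c hc => J.mul_mem_left _ ?_
    rw [Finset.mem_filter] at hc
    exact h c hc.1 c₀ hc₀ hc.2 hs₀

lemma support_binomial {a b : Fin (d + 1) →₀ ℕ} (h : a ≠ b) :
    (binomial k a b).support = {a, b} := by
  ext c
  rw [mem_support_iff, binomial, coeff_sub, coeff_monomial, coeff_monomial, Finset.mem_insert,
    Finset.mem_singleton]
  by_cases h1 : a = c
  · have h2 : ¬ b = c := fun h2 => h (h1.trans h2.symm)
    simp [h1, h2]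
  · by_cases h2 : b = c
    · simp [h1, h2]
    · simp [h1, h2, eq_comm]

lemma binomial_self (a : Fin (d + 1) →₀ ℕ) : binomial k a a = 0 := sub_self _

lemma neg_binomial (a b : Fin (d + 1) →₀ ℕ) : -binomial k a b = binomial k b a := neg_sub _ _

lemma binomial_add_binomial (a b c : Fin (d + 1) →₀ ℕ) :
    binomial k a b + binomial k b c = binomial k a c := sub_add_sub_cancel _ _ _

lemma monomial_mul_binomial (w a b : Fin (d + 1) →₀ ℕ) :
    monomial w 1 * binomial k a b = binomial k (w + a) (w + b) := by
  simp [binomial, mul_sub, monomial_mul]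

/-! ### Moves along binomials -/

/-- One move along a binomial `x ^ u - x ^ v` of `E`: from `x ^ (w + u)` to `x ^ (w + v)`. -/
def Move (E : Set (MvPolynomial (Fin (d + 1)) k)) (a b : Fin (d + 1) →₀ ℕ) : Prop :=
  ∃ u v w, binomial k u v ∈ E ∧ a = w + u ∧ b = w + v

/-- Any two factorizations of the same element are joined by a chain of moves along `E`. -/
def Connects (n : Fin (d + 1) → ℕ) (E : Set (MvPolynomial (Fin (d + 1)) k)) : Prop :=
  ∀ a b, value n a = value n b → Relation.EqvGen (Move E) a b

/-- The linear form adding up the coefficients over the class of `a` vanishes on the span of `E`;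
its value on `x ^ a - x ^ b` is nonzero unless `b` lies in the class of `a`. -/
lemma eqvGen_of_binomial_mem_span {E : Set (MvPolynomial (Fin (d + 1)) k)}
    (hE : IsBinomialSet E) {a b : Fin (d + 1) →₀ ℕ} (h : binomial k a b ∈ Ideal.span E) :
    Relation.EqvGen (Move E) a b := by
  classical
  let φ : MvPolynomial (Fin (d + 1)) k →ₗ[k] k := (basisMonomials (Fin (d + 1)) k).constr k
    fun c => if Relation.EqvGen (Move E) a c then (1 : k) else 0
  have hφ1 : ∀ c, φ (monomial c 1) = if Relation.EqvGen (Move E) a c then (1 : k) else 0 := by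
    intro c
    have := (basisMonomials (Fin (d + 1)) k).constr_basis k
      (fun c => if Relation.EqvGen (Move E) a c then (1 : k) else 0) c
    rwa [coe_basisMonomials] at this
  have hvan : ∀ f ∈ Ideal.span E, ∀ g, φ (g * f) = 0 := by
    intro f hf
    induction hf using Submodule.span_induction with
    | mem f hf =>
      obtain ⟨u, v, rfl⟩ := hE f hf
      intro g
      induction g using MvPolynomial.induction_on' with
      | monomial w r =>
        have hw : monomial w r = r • monomial w (1 : k) := by simp [smul_monomial]
        have hmv : Move E (w + u) (w + v) := ⟨u, v, w, hf, rfl, rfl⟩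
        have hiff : Relation.EqvGen (Move E) a (w + u) ↔ Relation.EqvGen (Move E) a (w + v) :=
          ⟨fun h => h.trans _ _ _ (.rel _ _ hmv),
            fun h => h.trans _ _ _ (.symm _ _ (.rel _ _ hmv))⟩
        rw [hw, smul_mul_assoc, map_smul, monomial_mul_binomial, binomial, map_sub, hφ1, hφ1]
        simp only [hiff, sub_self, smul_zero]
      | add p q hp hq => rw [add_mul, map_add, hp, hq, add_zero]
    | zero => simp
    | add f g _ _ hf hg => intro p; rw [mul_add, map_add, hf, hg, add_zero]
    | smul p f _ hf => intro q; rw [smul_eq_mul, ← mul_assoc]; exact hf _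
  have h0 := hvan _ h 1
  rw [one_mul, binomial, map_sub, hφ1, hφ1, if_pos (Relation.EqvGen.refl a)] at h0
  by_contra hab
  rw [if_neg hab] at h0
  simp at h0

lemma connects_of_span_eq {E : Set (MvPolynomial (Fin (d + 1)) k)} (hE : IsBinomialSet E)
    (h : Ideal.span E = definingIdeal k n) : Connects n E := fun a b hab =>
  eqvGen_of_binomial_mem_span hE (by rw [h]; exact binomial_mem_definingIdeal.2 hab)

lemma binomial_mem_span_of_eqvGen {E : Set (MvPolynomial (Fin (d + 1)) k)}
    {a b : Fin (d + 1) →₀ ℕ} (h : Relation.EqvGen (Move E) a b) :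
    binomial k a b ∈ Ideal.span E := by
  induction h with
  | rel a b h =>
    obtain ⟨u, v, w, huv, rfl, rfl⟩ := h
    rw [← monomial_mul_binomial]
    exact Ideal.mul_mem_left _ _ (Ideal.subset_span huv)
  | refl a => rw [binomial_self]; exact Ideal.zero_mem _
  | symm a b _ ih => rw [← neg_binomial]; exact Submodule.neg_mem _ ih
  | trans a b c _ _ h1 h2 => rw [← binomial_add_binomial a b c]; exact Ideal.add_mem _ h1 h2

lemma span_eq_of_connects {E : Set (MvPolynomial (Fin (d + 1)) k)}
    (hE : E ⊆ (definingIdeal k n : Set (MvPolynomial (Fin (d + 1)) k))) (h : Connects n E) :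
    Ideal.span E = definingIdeal k n := by
  refine le_antisymm (Ideal.span_le.2 hE) fun f hf => ?_
  rw [f.as_sum]
  exact sum_monomial_mem n _ _ _ fun s => Or.inr ⟨sum_coeff_eq_zero hf s,
    fun c _ c' _ hc hc' => binomial_mem_span_of_eqvGen (h c c' (hc.trans hc'.symm))⟩

lemma Move.value_eq {E : Set (MvPolynomial (Fin (d + 1)) k)}
    (hE : E ⊆ (definingIdeal k n : Set (MvPolynomial (Fin (d + 1)) k)))
    {a b : Fin (d + 1) →₀ ℕ} (h : Move E a b) : value n a = value n b := by
  obtain ⟨u, v, w, huv, rfl, rfl⟩ := h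
  rw [value_add, value_add, binomial_mem_definingIdeal.1 (hE huv)]

lemma value_eq_of_eqvGen {E : Set (MvPolynomial (Fin (d + 1)) k)}
    (hE : E ⊆ (definingIdeal k n : Set (MvPolynomial (Fin (d + 1)) k)))
    {a b : Fin (d + 1) →₀ ℕ} (h : Relation.EqvGen (Move E) a b) : value n a = value n b := by
  induction h with
  | rel a b h => exact h.value_eq hE
  | refl a => rfl
  | symm a b _ ih => exact ih.symm
  | trans a b c _ _ h1 h2 => exact h1.trans h2

/-- If the first variable divides the longer terms of `E`, then the longer end of a move that
changes the length is divisible by it. -/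
lemma Move.first_ne_zero {E : Set (MvPolynomial (Fin (d + 1)) k)}
    (hE : FirstVarDividesLongerTerms E) {a b : Fin (d + 1) →₀ ℕ} (h : Move E a b) :
    (a.degree < b.degree → b 0 ≠ 0) ∧ (b.degree < a.degree → a 0 ≠ 0) := by
  obtain ⟨u, v, w, huv, rfl, rfl⟩ := h
  simp only [map_add, Finsupp.add_apply]
  constructor
  · intro h
    have := hE v u (Or.inr huv) (by omega)
    omega
  · intro h
    have := hE u v (Or.inl huv) (by omega)
    omega

/-- Without factorizations involving the first generator no move can change the length. -/
lemma lengthsForceFirst_of_connects {E : Set (MvPolynomial (Fin (d + 1)) k)}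
    (hI : E ⊆ (definingIdeal k n : Set (MvPolynomial (Fin (d + 1)) k)))
    (hE : FirstVarDividesLongerTerms E) (h : Connects n E) : LengthsForceFirst n := by
  intro a b hab hlt
  by_contra! hno
  have key : ∀ x y, Relation.EqvGen (Move E) x y → value n x = value n a →
      x.degree = y.degree := by
    intro x y hxy
    induction hxy with
    | rel x y hxy =>
      intro hx
      have h1 := hno x hx
      have h2 := hno y ((hxy.value_eq hI).symm.trans hx)
      have h3 := hxy.first_ne_zero hE
      omega
    | refl x => exact fun _ => rfl
    | symm x y hxy ih => exact fun hy => (ih ((value_eq_of_eqvGen hI hxy).trans hy)).symm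
    | trans x y z hxy _ h1 h2 =>
      exact fun hx => (h1 hx).trans (h2 ((value_eq_of_eqvGen hI hxy).symm.trans hx))
  have := key a b (h a b hab) rfl
  omega

/-- If `a` is maximal, then no factorization of `value (a + e₀)` longer than `a + e₀` involves the
first generator; hence no chain of moves can pass from length `|a| + 1` to a larger length. -/
lemma firstPreservesMaximality_of_connects {E : Set (MvPolynomial (Fin (d + 1)) k)}
    (hI : E ⊆ (definingIdeal k n : Set (MvPolynomial (Fin (d + 1)) k)))
    (hE : FirstVarDividesLongerTerms E) (h : Connects n E) : FirstPreservesMaximality n := by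
  intro a ha
  rw [isMaximalFactorization_iff] at ha
  have hfirst : ∀ x, value n x = value n (a + Finsupp.single 0 1) → x 0 ≠ 0 →
      x.degree ≤ a.degree + 1 := by
    intro x hx hx0
    obtain ⟨y, rfl⟩ := exists_eq_add_single hx0
    rw [value_add, value_add] at hx
    have := ha y (by omega)
    rw [degree_add_single]
    omega
  have key : ∀ x y, Relation.EqvGen (Move E) x y →
      value n x = value n (a + Finsupp.single 0 1) →
      (x.degree ≤ a.degree + 1 ↔ y.degree ≤ a.degree + 1) := by
    intro x y hxy
    induction hxy with
    | rel x y hxy =>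
      intro hx
      have h1 := hfirst x hx
      have h2 := hfirst y ((hxy.value_eq hI).symm.trans hx)
      have h3 := hxy.first_ne_zero hE
      omega
    | refl x => exact fun _ => Iff.rfl
    | symm x y hxy ih => exact fun hy => (ih ((value_eq_of_eqvGen hI hxy).trans hy)).symm
    | trans x y z hxy _ h1 h2 =>
      exact fun hx => (h1 hx).trans (h2 ((value_eq_of_eqvGen hI hxy).symm.trans hx))
  rw [isMaximalFactorization_iff]
  intro b hb
  rw [degree_add_single]
  refine (key _ b (h _ b hb.symm) rfl).1 ?_
  rw [degree_add_single]

/-- The condition on pairs of factorizations splits into the two combinatorial conditions. -/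
lemma pair_condition_iff : (∀ a b : Fin (d + 1) →₀ ℕ,
      binomial k a b ∈ definingIdeal k n → b.degree < a.degree →
        value n a ∉ apery (semigroup n) (n 0) ∧
        (a 0 + b 0 ≠ 0 → IsMaximalFactorization n (bar b) → b 0 ≤ a 0)) ↔
    LengthsForceFirst n ∧ FirstPreservesMaximality n := by
  simp only [binomial_mem_definingIdeal, value_notMem_apery_iff]
  constructor
  · intro h
    refine ⟨fun a b hab hlt => (h a b hab hlt).1, fun c hc => ?_⟩
    by_contra hnot
    obtain ⟨a, ha, hlt⟩ := (not_isMaximalFactorization_iff n _).1 hnot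
    have h2 := (h a _ ha hlt).2 (by simp)
    rw [bar, if_neg (by simp), add_tsub_cancel_right] at h2
    have h3 := h2 hc
    have ha0 : a 0 ≠ 0 := by
      simp only [Finsupp.add_apply, Finsupp.single_eq_same] at h3
      omega
    obtain ⟨a', rfl⟩ := exists_eq_add_single ha0
    rw [value_add, value_add] at ha
    have h4 := (isMaximalFactorization_iff n c).1 hc a' (by omega)
    rw [degree_add_single, degree_add_single] at hlt
    omega
  · rintro ⟨h1, h2⟩ a b hab hlt
    refine ⟨h1 a b hab hlt, fun _ hb => ?_⟩
    by_contra hba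
    have hb0 : b 0 ≠ 0 := by omega
    obtain ⟨c, rfl⟩ := exists_eq_add_single hb0
    rw [bar, if_neg hb0, add_tsub_cancel_right] at hb
    have := (isMaximalFactorization_iff n _).1 (h2 c hb) a hab
    omega

lemma isHomogeneousSemigroup_iff (hpos : ∀ i, 0 < n i) :
     IsHomogeneousSemigroup n ↔ LengthsForceFirst n := by
  constructor
  · intro h a b hab hlt
    rw [← value_notMem_apery_iff]
    intro hap
    have key : value n a ≠ 0 := by
      have := degree_le_value hpos a
      omega
    obtain ⟨l, hl⟩ := h _ hap key
    have h1 : a.degree ∈ lengths n (value n a) := ⟨a, rfl, rfl⟩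
    have h2 : b.degree ∈ lengths n (value n a) := ⟨b, hab.symm, rfl⟩
    rw [hl, Set.mem_singleton_iff] at h1 h2
    omega
  · intro h s hs _
    obtain ⟨a, rfl⟩ := exists_value_eq_of_mem_semigroup n hs.1
    refine ⟨a.degree, Set.eq_singleton_iff_unique_mem.2 ⟨⟨a, rfl, rfl⟩, ?_⟩⟩
    rintro _ ⟨b, hb, rfl⟩
    have hb' : value n b = value n a := hb
    have hno := fun h' => (value_notMem_apery_iff n a).2 h' hs
    rcases lt_trichotomy b.degree a.degree with h1 | h1 | h1
    · exact absurd (h a b hb'.symm h1) hno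
    · exact h1
    · have := h b a hb' h1
      rw [hb'] at this
      exact absurd this hno

end Ideal

/-! ### Standard bases -/

section StandardBases

variable {k : Type*} [Field k] {d : ℕ} {n : Fin (d + 1) → ℕ}

lemma leastDegree_eq {f : MvPolynomial (Fin (d + 1)) k} {c : Fin (d + 1) →₀ ℕ}
    (hc : c ∈ f.support) (h : ∀ b ∈ f.support, c.degree ≤ b.degree) :
    leastDegree f = c.degree := by
  refine IsLeast.csInf_eq ⟨⟨c, hc, rfl⟩, ?_⟩
  rintro _ ⟨b, hb, rfl⟩
  exact h b hb

lemma homogeneousComponent_monomial (m : ℕ) (a : Fin (d + 1) →₀ ℕ) (r : k) :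
    homogeneousComponent m (monomial a r) = if m = a.degree then monomial a r else 0 :=
  homogeneousComponent_of_mem (isHomogeneous_monomial r rfl)

lemma initialForm_neg (f : MvPolynomial (Fin (d + 1)) k) :
    initialForm (-f) = -initialForm f := by
  simp only [initialForm, leastDegree, support_neg, map_neg]

lemma initialForm_binomial_of_lt {a b : Fin (d + 1) →₀ ℕ} (h : b.degree < a.degree) :
    initialForm (binomial k a b) = -monomial b 1 := by
  have hab : a ≠ b := fun h' => by rw [h'] at h; exact lt_irrefl _ h
  have hl : leastDegree (binomial k a b) = b.degree := by
    apply leastDegree_eq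
    · rw [support_binomial hab]; simp
    · intro c hc
      rw [support_binomial hab, Finset.mem_insert, Finset.mem_singleton] at hc
      rcases hc with rfl | rfl
      · exact h.le
      · exact le_rfl
  rw [initialForm, hl, binomial, map_sub, homogeneousComponent_monomial,
    homogeneousComponent_monomial, if_neg h.ne, if_pos rfl, zero_sub]

lemma initialForm_binomial_of_eq {a b : Fin (d + 1) →₀ ℕ} (h : a.degree = b.degree) :
    initialForm (binomial k a b) = binomial k a b := by
  by_cases hab : a = b
  · rw [hab, binomial_self, initialForm, map_zero]
  have hl : leastDegree (binomial k a b) = b.degree := by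
    apply leastDegree_eq
    · rw [support_binomial hab]; simp
    · intro c hc
      rw [support_binomial hab, Finset.mem_insert, Finset.mem_singleton] at hc
      rcases hc with rfl | rfl
      · exact h.ge
      · exact le_rfl
  rw [initialForm, hl, binomial, map_sub, homogeneousComponent_monomial,
    homogeneousComponent_monomial, if_pos h.symm, if_pos rfl]

/-- Modulo `J`, the monomial `x ^ a` either vanishes because of a longer factorization, or is
congruent to a monomial of the same value and length that is divisible by the first variable. -/
def Descends (n : Fin (d + 1) → ℕ) (J : Ideal (MvPolynomial (Fin (d + 1)) k))
    (a : Fin (d + 1) →₀ ℕ) : Prop :=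
  ∃ a', value n a' = value n a ∧ a'.degree = a.degree ∧ binomial k a a' ∈ J ∧
    ((¬ IsMaximalFactorization n a' ∧ monomial a' (1 : k) ∈ J) ∨ a' 0 ≠ 0)

lemma Descends.of_binomial_mem {J : Ideal (MvPolynomial (Fin (d + 1)) k)}
    {a b : Fin (d + 1) →₀ ℕ} (hb : Descends n J b) (hv : value n a = value n b)
    (hd : a.degree = b.degree) (hab : binomial k a b ∈ J) : Descends n J a := by
  obtain ⟨b', h1, h2, h3, h4⟩ := hb
  refine ⟨b', h1.trans hv.symm, h2.trans hd.symm, ?_, h4⟩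
  rw [← binomial_add_binomial a b b']
  exact J.add_mem hab h3

/-- Along a chain of moves, either the length never changes, or each of the two ends is joined, by
moves of constant length, to one end of a move that changes the length. -/
lemma binomial_mem_or_descends {E : Set (MvPolynomial (Fin (d + 1)) k)}
    (hI : E ⊆ (definingIdeal k n : Set (MvPolynomial (Fin (d + 1)) k)))
    (hE : FirstVarDividesLongerTerms E) {a b : Fin (d + 1) →₀ ℕ}
    (h : Relation.EqvGen (Move E) a b) :
    (a.degree = b.degree ∧ binomial k a b ∈ Ideal.span (initialForm '' E)) ∨
      (Descends n (Ideal.span (initialForm '' E)) a ∧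
        Descends n (Ideal.span (initialForm '' E)) b) := by
  have hpair : ∀ u v w : Fin (d + 1) →₀ ℕ, (binomial k u v ∈ E ∨ binomial k v u ∈ E) →
      v.degree < u.degree → Descends n (Ideal.span (initialForm '' E)) (w + u) ∧
        Descends n (Ideal.span (initialForm '' E)) (w + v) := by
    intro u v w huv hlt
    have hu := hE u v huv hlt
    have hval : value n u = value n v := by
      rcases huv with h | h
      · exact binomial_mem_definingIdeal.1 (hI h)
      · exact (binomial_mem_definingIdeal.1 (hI h)).symm
    have hv : monomial v (1 : k) ∈ Ideal.span (initialForm '' E) := by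
      rcases huv with h | h
      · have := Ideal.subset_span (s := initialForm '' E) ⟨_, h, initialForm_binomial_of_lt hlt⟩
        exact neg_mem_iff.1 this
      · have h1 : initialForm (binomial k v u) = monomial v 1 := by
          rw [← neg_binomial, initialForm_neg, initialForm_binomial_of_lt hlt, neg_neg]
        exact Ideal.subset_span ⟨_, h, h1⟩
    constructor
    · refine ⟨w + u, rfl, rfl, by rw [binomial_self]; exact Ideal.zero_mem _, Or.inr ?_⟩
      rw [Finsupp.add_apply]
      omega
    · refine ⟨w + v, rfl, rfl, by rw [binomial_self]; exact Ideal.zero_mem _, Or.inl ⟨?_, ?_⟩⟩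
      · rw [not_isMaximalFactorization_iff]
        exact ⟨w + u, by rw [value_add, value_add, hval], by rw [map_add, map_add]; omega⟩
      · have := Ideal.mul_mem_left _ (monomial w (1 : k)) hv
        rwa [monomial_mul, mul_one] at this
  induction h with
  | rel a b h =>
    obtain ⟨u, v, w, huv, rfl, rfl⟩ := h
    rcases lt_trichotomy u.degree v.degree with h | h | h
    · exact Or.inr (hpair v u w (Or.inr huv) h).symm
    · refine Or.inl ⟨by rw [map_add, map_add, h], ?_⟩
      rw [← monomial_mul_binomial]
      exact Ideal.mul_mem_left _ _ (Ideal.subset_span ⟨_, huv, initialForm_binomial_of_eq h⟩)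
    · exact Or.inr (hpair u v w (Or.inl huv) h)
  | refl a => exact Or.inl ⟨rfl, by rw [binomial_self]; exact Ideal.zero_mem _⟩
  | symm a b _ ih =>
    rcases ih with ⟨h1, h2⟩ | ⟨h1, h2⟩
    · exact Or.inl ⟨h1.symm, by rw [← neg_binomial]; exact Submodule.neg_mem _ h2⟩
    · exact Or.inr ⟨h2, h1⟩
  | trans a b c hab hbc ih1 ih2 =>
    have hva := value_eq_of_eqvGen hI hab
    have hvb := value_eq_of_eqvGen hI hbc
    rcases ih1 with ⟨h1, h2⟩ | ⟨h1, h2⟩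
    · rcases ih2 with ⟨h3, h4⟩ | ⟨h3, h4⟩
      · refine Or.inl ⟨h1.trans h3, ?_⟩
        rw [← binomial_add_binomial a b c]
        exact Ideal.add_mem _ h2 h4
      · exact Or.inr ⟨h3.of_binomial_mem hva h1 h2, h4⟩
    · rcases ih2 with ⟨h3, h4⟩ | ⟨h3, h4⟩
      · refine Or.inr ⟨h1, h2.of_binomial_mem hvb.symm h3.symm ?_⟩
        rw [← neg_binomial]
        exact Submodule.neg_mem _ h4
      · exact Or.inr ⟨h1, h4⟩

/-- By induction on the value: the first variable can be cancelled, since it is a nonzerodivisor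
on the tangent cone. -/
lemma initialForms_generate {E : Set (MvPolynomial (Fin (d + 1)) k)} (hpos : ∀ i, 0 < n i)
    (hI : E ⊆ (definingIdeal k n : Set (MvPolynomial (Fin (d + 1)) k)))
    (hE : FirstVarDividesLongerTerms E) (hc : Connects n E) (hn : FirstPreservesMaximality n)
    (s : ℕ) : ∀ a, value n a = s →
      (¬ IsMaximalFactorization n a → monomial a (1 : k) ∈ Ideal.span (initialForm '' E)) ∧
      ∀ b, value n b = s → a.degree = b.degree →
        binomial k a b ∈ Ideal.span (initialForm '' E) := by
  set J := Ideal.span (initialForm '' E)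
  induction s using Nat.strong_induction_on with
  | _ s ih =>
    have h1 : ∀ a, value n a = s → ¬ IsMaximalFactorization n a → monomial a (1 : k) ∈ J := by
      intro a ha hmax
      obtain ⟨b, hb, hlt⟩ := (not_isMaximalFactorization_iff n a).1 hmax
      rcases binomial_mem_or_descends hI hE (hc a b hb.symm) with h | h
      · exact absurd h.1 hlt.ne
      obtain ⟨a', hv, hd, hbin, h'⟩ := h.1
      have ha' : monomial a' (1 : k) ∈ J := by
        rcases h' with h' | h'
        · exact h'.2
        · obtain ⟨c, rfl⟩ := exists_eq_add_single h'
          have hcmax : ¬ IsMaximalFactorization n c := by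
            intro hcm
            have := (isMaximalFactorization_iff n _).1 (hn c hcm) b (hb.trans hv.symm)
            omega
          have hvc : value n c < s := by
            rw [value_add, value_single, one_mul] at hv
            have := hpos 0
            omega
          have := J.mul_mem_right (monomial (Finsupp.single 0 1) (1 : k))
            ((ih _ hvc c rfl).1 hcmax)
          rwa [monomial_mul, mul_one] at this
      have := J.add_mem hbin ha'
      rwa [binomial, sub_add_cancel] at this
    intro a ha
    refine ⟨h1 a ha, fun b hb hdeg => ?_⟩
    by_cases hmax : IsMaximalFactorization n a
    · have hbmax : IsMaximalFactorization n b := by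
        rw [isMaximalFactorization_iff] at hmax ⊢
        intro c hc
        rw [← hdeg]
        exact hmax c (hc.trans (hb.trans ha.symm))
      rcases binomial_mem_or_descends hI hE (hc a b (ha.trans hb.symm)) with h | ⟨hDa, hDb⟩
      · exact h.2
      have strip : ∀ x, value n x = s → IsMaximalFactorization n x → Descends n J x →
          ∃ y, value n y + n 0 = s ∧ y.degree + 1 = x.degree ∧
            binomial k x (y + Finsupp.single 0 1) ∈ J := by
        rintro x hx hxm ⟨x', hv, hd, hbin, h'⟩
        have hx'm : IsMaximalFactorization n x' := by
          rw [isMaximalFactorization_iff] at hxm ⊢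
          intro c hc
          rw [hd]
          exact hxm c (hc.trans hv)
        obtain ⟨y, rfl⟩ := exists_eq_add_single (h'.resolve_left fun h => h.1 hx'm)
        refine ⟨y, ?_, ?_, hbin⟩
        · rw [← hx, ← hv, value_add, value_single, one_mul]
        · rw [← hd, degree_add_single]
      obtain ⟨y, hyv, hyd, hy⟩ := strip a ha hmax hDa
      obtain ⟨z, hzv, hzd, hz⟩ := strip b hb hbmax hDb
      have hys : value n y < s := by
        have := hpos 0
        omega
      have hyz := J.mul_mem_left (monomial (Finsupp.single 0 1) (1 : k))
        ((ih _ hys y rfl).2 z (by omega) (by omega))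
      rw [monomial_mul_binomial, add_comm _ y, add_comm _ z] at hyz
      rw [← binomial_add_binomial a _ b]
      refine J.add_mem hy ?_
      rw [← binomial_add_binomial _ _ b]
      refine J.add_mem hyz ?_
      rw [← neg_binomial]
      exact J.neg_mem hz
    · have hbmax : ¬ IsMaximalFactorization n b := by
        rw [not_isMaximalFactorization_iff] at hmax ⊢
        obtain ⟨c, hc, hlt⟩ := hmax
        exact ⟨c, hc.trans (ha.trans hb.symm), by omega⟩
      exact J.sub_mem (h1 a ha hmax) (h1 b hb hbmax)

/-- A generating set of binomials whose longer terms are divisible by the first variable is a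
standard basis. -/
lemma isStandardBasis_of_span_eq {E : Set (MvPolynomial (Fin (d + 1)) k)} (hpos : ∀ i, 0 < n i)
    (hB : IsBinomialSet E) (hspan : Ideal.span E = definingIdeal k n)
    (hE : FirstVarDividesLongerTerms E) : IsStandardBasis (definingIdeal k n) E := by
  have hI : E ⊆ (definingIdeal k n : Set (MvPolynomial (Fin (d + 1)) k)) := by
    rw [← hspan]; exact Ideal.subset_span
  have hc := connects_of_span_eq hB hspan
  have hn := firstPreservesMaximality_of_connects hI hE hc
  have key := initialForms_generate hpos hI hE hc hn
  refine ⟨hI, le_antisymm (Ideal.span_mono (Set.image_mono hI)) (Ideal.span_le.2 ?_)⟩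
  rintro _ ⟨f, hf, rfl⟩
  rw [initialForm, homogeneousComponent_apply]
  refine sum_monomial_mem n _ _ (fun c => coeff c f) fun s => ?_
  -- in value `s`, either some term of `f` is longer than the least degree, or none is
  by_cases hs : ∃ b ∈ f.support, value n b = s ∧ leastDegree f < b.degree
  · left
    obtain ⟨b, _, hbs, hlt⟩ := hs
    intro c hc hcs
    refine (key s c hcs).1 ((not_isMaximalFactorization_iff n c).2 ⟨b, hbs.trans hcs.symm, ?_⟩)
    rw [(Finset.mem_filter.1 hc).2]
    exact hlt
  · right
    push Not at hs
    constructor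
    · rw [← sum_coeff_eq_zero hf s, Finset.filter_filter]
      refine Finset.sum_congr (Finset.filter_congr fun c hc => ?_) fun _ _ => rfl
      refine and_iff_right_of_imp fun hcs => le_antisymm (hs c hc hcs) ?_
      exact Nat.sInf_le ⟨c, hc, rfl⟩
    · intro c hc c' hc' hcs hcs'
      exact (key s c hcs).2 c' hcs'
        ((Finset.mem_filter.1 hc).2.trans (Finset.mem_filter.1 hc').2.symm)

end StandardBases

/-! ### The negative degree reverse lexicographic order -/

section Order

variable {d : ℕ}

lemma dsLT_irrefl (a : Fin (d + 1) →₀ ℕ) : ¬ dsLT a a := by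
  rintro (h | h | ⟨_, _, i, _, _, h⟩)
  · exact lt_irrefl _ h
  · exact lt_irrefl _ h.2
  · exact lt_irrefl _ h

lemma dsLT_trans {a b c : Fin (d + 1) →₀ ℕ} (h₁ : dsLT a b) (h₂ : dsLT b c) : dsLT a c := by
  rcases h₁ with h₁ | h₁ | ⟨h₁, h₁', i, hi, hi', hi''⟩ <;>
    rcases h₂ with h₂ | h₂ | ⟨h₂, h₂', j, hj, hj', hj''⟩
  · exact Or.inl (by omega)
  · exact Or.inl (by omega)
  · exact Or.inl (by omega)
  · exact Or.inl (by omega)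
  · exact Or.inr (Or.inl (by omega))
  · exact Or.inr (Or.inl (by omega))
  · exact Or.inl (by omega)
  · exact Or.inr (Or.inl (by omega))
  · refine Or.inr (Or.inr ⟨by omega, by omega, ?_⟩)
    rcases lt_trichotomy i j with hij | rfl | hij
    · refine ⟨j, hj, fun l hl => ?_, ?_⟩
      · rw [hi' l (hij.trans hl), hj' l hl]
      · rw [hi' j hij]; exact hj''
    · exact ⟨i, hi, fun l hl => by rw [hi' l hl, hj' l hl], hj''.trans hi''⟩
    · refine ⟨i, hi, fun l hl => ?_, ?_⟩
      · rw [hi' l hl, hj' l (hij.trans hl)]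
      · rw [← hj' i hij]; exact hi''

instance : IsStrictOrder (Fin (d + 1) →₀ ℕ) dsLT where
  irrefl := dsLT_irrefl
  trans _ _ _ := dsLT_trans

lemma dsLT_trichotomy (a b : Fin (d + 1) →₀ ℕ) : dsLT a b ∨ a = b ∨ dsLT b a := by
  by_cases hab : a = b
  · exact Or.inr (Or.inl hab)
  rcases lt_trichotomy a.degree b.degree with h | h | h
  · exact Or.inr (Or.inr (Or.inl h))
  · rcases lt_trichotomy (a 0) (b 0) with h0 | h0 | h0
    · exact Or.inr (Or.inr (Or.inr (Or.inl ⟨h.symm, h0⟩)))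
    · -- compare at the last coordinate where the two vectors differ
      have hne : (Finset.univ.filter fun i => a i ≠ b i).Nonempty := by
        obtain ⟨i, hi⟩ := Finsupp.ne_iff.1 hab
        exact ⟨i, by simpa using hi⟩
      obtain ⟨i, hi, hmax⟩ := Finset.exists_max_image _ id hne
      have hi' : a i ≠ b i := by simpa using hi
      have hlast : ∀ j, i < j → a j = b j := by
        intro j hij
        by_contra hj
        exact absurd (hmax j (by simpa using hj)) (not_le.2 hij)
      have hi0 : i ≠ 0 := by
        rintro rfl
        exact hi' h0
      rcases lt_or_gt_of_ne hi' with h1 | h1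
      · exact Or.inr (Or.inr (Or.inr (Or.inr
          ⟨h.symm, h0.symm, i, hi0, fun j hj => (hlast j hj).symm, h1⟩)))
      · exact Or.inl (Or.inr (Or.inr ⟨h, h0, i, hi0, hlast, h1⟩))
    · exact Or.inl (Or.inr (Or.inl ⟨h, h0⟩))
  · exact Or.inl (Or.inl h)

lemma dsLT_add_left_iff {a b : Fin (d + 1) →₀ ℕ} (w : Fin (d + 1) →₀ ℕ) :
    dsLT (w + a) (w + b) ↔ dsLT a b := by
  simp only [dsLT, map_add, Finsupp.add_apply, add_lt_add_iff_left, add_right_inj]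

lemma dsLT.degree_le {a b : Fin (d + 1) →₀ ℕ} (h : dsLT b a) : a.degree ≤ b.degree := by
  rcases h with h | h | h
  · exact h.le
  · exact h.1.ge
  · exact h.1.ge

lemma dsLT.first_le {a b : Fin (d + 1) →₀ ℕ} (h : dsLT b a) (hd : a.degree = b.degree) :
    a 0 ≤ b 0 := by
  rcases h with h | h | h
  · exact absurd hd h.ne
  · exact h.2.le
  · exact h.2.1.ge

/-- `a` is the least factorization of its value with respect to the order. -/
def IsReduced (n : Fin (d + 1) → ℕ) (a : Fin (d + 1) →₀ ℕ) : Prop :=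
  ∀ b, value n b = value n a → ¬ dsLT b a

variable {n : Fin (d + 1) → ℕ}

lemma not_isReduced_iff {a : Fin (d + 1) →₀ ℕ} :
    ¬ IsReduced n a ↔ ∃ b, value n b = value n a ∧ dsLT b a := by
  simp only [IsReduced]
  push Not
  rfl

lemma IsReduced.isMaximalFactorization {a : Fin (d + 1) →₀ ℕ} (h : IsReduced n a) :
    IsMaximalFactorization n a := by
  rw [isMaximalFactorization_iff]
  intro b hb
  by_contra! hlt
  exact h b hb (Or.inl hlt)

lemma IsReduced.eq {a b : Fin (d + 1) →₀ ℕ} (ha : IsReduced n a) (hb : IsReduced n b)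
    (h : value n a = value n b) : a = b := by
  rcases dsLT_trichotomy a b with h1 | h1 | h1
  · exact absurd h1 (hb a h)
  · exact h1
  · exact absurd h1 (ha b h.symm)

lemma IsReduced.of_le {a b : Fin (d + 1) →₀ ℕ} (hb : IsReduced n b) (hab : a ≤ b) :
    IsReduced n a := by
  obtain ⟨w, rfl⟩ := exists_add_of_le hab
  intro c hc hlt
  refine hb (w + c) (by rw [value_add, value_add, hc, add_comm]) ?_
  rw [add_comm a w, dsLT_add_left_iff]
  exact hlt

/-- Induction along reductions to smaller factorizations of the same value, which terminate
because an element has finitely many factorizations. -/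
lemma reduction_induction (hpos : ∀ i, 0 < n i) {p : (Fin (d + 1) →₀ ℕ) → Prop}
    (hred : ∀ a, IsReduced n a → p a)
    (hstep : ∀ a, ¬ IsReduced n a → (∀ b, value n b = value n a → dsLT b a → p b) → p a)
    (a : Fin (d + 1) →₀ ℕ) : p a := by
  have hwf := (finite_factorizations hpos (value n a)).wellFoundedOn (r := dsLT)
  refine hwf.induction (x := a) rfl fun b hb ih => ?_
  by_cases h : IsReduced n b
  · exact hred b h
  · exact hstep b h fun c hc hlt => ih c (hc.trans hb) hlt

lemma exists_isReduced (hpos : ∀ i, 0 < n i) (a : Fin (d + 1) →₀ ℕ) :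
    ∃ r, value n r = value n a ∧ IsReduced n r := by
  induction a using reduction_induction hpos with
  | hred a h => exact ⟨a, rfl, h⟩
  | hstep a h ih =>
    obtain ⟨b, hb, hlt⟩ := not_isReduced_iff.1 h
    obtain ⟨r, hr, hr'⟩ := ih b hb hlt
    exact ⟨r, hr.trans hb, hr'⟩

/-- The first variable is the smallest one, so multiplying by it keeps the least factorization
the least among those of maximal length. -/
lemma IsReduced.add_single (hn : FirstPreservesMaximality n) {a : Fin (d + 1) →₀ ℕ}
    (ha : IsReduced n a) : IsReduced n (a + Finsupp.single 0 1) := by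
  intro b hb hlt
  have hmax := (isMaximalFactorization_iff n _).1 (hn a ha.isMaximalFactorization) b hb
  have hdeg := le_antisymm hlt.degree_le hmax
  have h0 := hlt.first_le hdeg
  have hb0 : b 0 ≠ 0 := by
    simp only [Finsupp.add_apply, Finsupp.single_eq_same] at h0
    omega
  obtain ⟨c, rfl⟩ := exists_eq_add_single hb0
  rw [value_add, value_add] at hb
  rw [add_comm c, add_comm a, dsLT_add_left_iff] at hlt
  exact ha c (by omega) hlt

end Order

/-! ### Groebner bases -/

section Groebner

variable {k : Type*} [Field k] {d : ℕ} {n : Fin (d + 1) → ℕ}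

lemma isLeadingExponent_binomial {a b : Fin (d + 1) →₀ ℕ} (h : dsLT b a)
    {c : Fin (d + 1) →₀ ℕ} : IsLeadingExponent (binomial k a b) c ↔ c = a := by
  have hab : a ≠ b := by
    rintro rfl
    exact dsLT_irrefl _ h
  simp only [IsLeadingExponent, support_binomial hab, Finset.mem_insert, Finset.mem_singleton]
  constructor
  · rintro ⟨rfl | rfl, h2⟩
    · rfl
    · exact absurd (dsLT_trans h (h2 a (Or.inl rfl) hab)) (dsLT_irrefl _)
  · rintro rfl
    refine ⟨Or.inl rfl, ?_⟩
    rintro x (rfl | rfl) hx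
    · exact absurd rfl hx
    · exact h

lemma monomial_mem_leadingMonomialIdeal {F : Set (MvPolynomial (Fin (d + 1)) k)}
    {a : Fin (d + 1) →₀ ℕ} : monomial a (1 : k) ∈ leadingMonomialIdeal F ↔
      ∃ f ∈ F, ∃ c, IsLeadingExponent f c ∧ c ≤ a := by
  have : {g : MvPolynomial (Fin (d + 1)) k | ∃ f ∈ F, ∃ c, IsLeadingExponent f c ∧
      g = monomial c 1} = (fun c => monomial c 1) '' {c | ∃ f ∈ F, IsLeadingExponent f c} := by
    ext g
    constructor
    · rintro ⟨f, hf, c, hc, rfl⟩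
      exact ⟨c, ⟨f, hf, hc⟩, rfl⟩
    · rintro ⟨c, ⟨f, hf, hc⟩, rfl⟩
      exact ⟨f, hf, c, hc, rfl⟩
  rw [leadingMonomialIdeal, this, mem_ideal_span_monomial_image]
  classical
  rw [support_monomial, if_neg one_ne_zero]
  constructor
  · intro h
    obtain ⟨c, ⟨f, hf, hc⟩, hca⟩ := h a (Finset.mem_singleton_self a)
    exact ⟨f, hf, c, hc, hca⟩
  · rintro ⟨f, hf, c, hc, hca⟩ b hb
    rw [Finset.mem_singleton.1 hb]
    exact ⟨c, ⟨f, hf, hc⟩, hca⟩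

lemma not_isReduced_of_isLeadingExponent {f : MvPolynomial (Fin (d + 1)) k}
    (hf : f ∈ definingIdeal k n) {c : Fin (d + 1) →₀ ℕ} (hc : IsLeadingExponent f c) :
    ¬ IsReduced n c := by
  intro hred
  -- `c` would be the only exponent of `f` of its value
  have hsum := sum_coeff_eq_zero hf (value n c)
  rw [Finset.sum_eq_single c] at hsum
  · exact mem_support_iff.1 hc.1 hsum
  · intro b hb hbc
    rw [Finset.mem_filter] at hb
    exact absurd (hc.2 b hb.1 hbc) (hred b hb.2)
  · intro h
    exact absurd (Finset.mem_filter (p := fun b => value n b = value n c).2 ⟨hc.1, rfl⟩) h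

lemma monomial_mem_leadingMonomialIdeal_definingIdeal {a : Fin (d + 1) →₀ ℕ} :
    monomial a (1 : k) ∈ leadingMonomialIdeal
      (definingIdeal k n : Set (MvPolynomial (Fin (d + 1)) k)) ↔ ¬ IsReduced n a := by
  rw [monomial_mem_leadingMonomialIdeal]
  constructor
  · rintro ⟨f, hf, c, hc, hca⟩ ha
    exact not_isReduced_of_isLeadingExponent hf hc (ha.of_le hca)
  · intro ha
    obtain ⟨b, hb, hlt⟩ := not_isReduced_iff.1 ha
    exact ⟨_, binomial_mem_definingIdeal.2 hb.symm, a,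
      (isLeadingExponent_binomial hlt).2 rfl, le_rfl⟩

/-- Division by a Groebner basis of binomials terminates, because each element has finitely many
factorizations; so the moves along it connect each factorization to the least one. -/
lemma IsGroebnerBasis.connects (hpos : ∀ i, 0 < n i) {G : Set (MvPolynomial (Fin (d + 1)) k)}
    (hB : IsBinomialSet G) (hG : IsGroebnerBasis (definingIdeal k n) G) : Connects n G := by
  have key : ∀ a, ∃ r, value n r = value n a ∧ IsReduced n r ∧
      Relation.EqvGen (Move G) a r := by
    intro a
    induction a using reduction_induction hpos with
    | hred a h => exact ⟨a, rfl, h, .refl a⟩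
    | hstep a h ih =>
      have hmem : monomial a (1 : k) ∈ leadingMonomialIdeal G := by
        rw [hG.2]
        exact monomial_mem_leadingMonomialIdeal_definingIdeal.2 h
      obtain ⟨f, hf, c, hc, hca⟩ := monomial_mem_leadingMonomialIdeal.1 hmem
      obtain ⟨w, rfl⟩ := exists_add_of_le hca
      have hstep : ∃ b, dsLT b c ∧ value n b = value n c ∧
          Relation.EqvGen (Move G) (c + w) (b + w) := by
        obtain ⟨u, v, rfl⟩ := hB f hf
        have huv : u ≠ v := by
          rintro rfl
          rw [binomial_self] at hc
          simpa using hc.1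
        have hval := binomial_mem_definingIdeal.1 (hG.1 hf)
        have hmv : Move G (u + w) (v + w) := ⟨u, v, w, hf, add_comm _ _, add_comm _ _⟩
        obtain ⟨hc1, hc2⟩ := hc
        simp only [support_binomial huv, Finset.mem_insert, Finset.mem_singleton] at hc1 hc2
        rcases hc1 with rfl | rfl
        · exact ⟨v, hc2 v (Or.inr rfl) huv.symm, hval.symm, .rel _ _ hmv⟩
        · exact ⟨u, hc2 u (Or.inl rfl) huv, hval, .symm _ _ (.rel _ _ hmv)⟩
      obtain ⟨b, hlt, hv, hbc⟩ := hstep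
      have hv' : value n (b + w) = value n (c + w) := by rw [value_add, value_add, hv]
      obtain ⟨r, hr, hred, hbr⟩ := ih (b + w) hv' (by
        rw [add_comm b, add_comm c, dsLT_add_left_iff]; exact hlt)
      exact ⟨r, hr.trans hv', hred, hbc.trans _ _ _ hbr⟩
  intro a b hab
  obtain ⟨r, hr, hr', har⟩ := key a
  obtain ⟨t, ht, ht', hbt⟩ := key b
  obtain rfl := hr'.eq ht' (hr.trans (hab.trans ht.symm))
  exact har.trans _ _ _ (.symm _ _ hbt)

lemma firstVarDividesLongerTerms_of_leading {G : Set (MvPolynomial (Fin (d + 1)) k)}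
    (hvars : ∀ f ∈ G, (¬ ∃ m, f.IsHomogeneous m) → 0 ∈ f.vars)
    (hlead : ∀ f ∈ G, ∀ c, IsLeadingExponent f c → c 0 = 0) : FirstVarDividesLongerTerms G := by
  intro a b hab hlt ha0
  have hne : a ≠ b := by
    rintro rfl
    exact lt_irrefl _ hlt
  obtain ⟨f, hf, hsupp⟩ : ∃ f ∈ G, f.support = {a, b} := by
    rcases hab with h | h
    · exact ⟨_, h, support_binomial hne⟩
    · exact ⟨_, h, by rw [support_binomial hne.symm, Finset.pair_comm]⟩
  have hb0 : b 0 = 0 := by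
    refine hlead f hf b ⟨by simp [hsupp], fun c hc hcb => ?_⟩
    simp only [hsupp, Finset.mem_insert, Finset.mem_singleton] at hc
    rcases hc with rfl | rfl
    · exact Or.inl hlt
    · exact absurd rfl hcb
  have hnh : ¬ ∃ m, f.IsHomogeneous m := by
    rintro ⟨m, hm⟩
    have ha : a.degree = m := by
      rw [Finsupp.degree_eq_weight_one]
      exact hm (mem_support_iff.1 (by simp [hsupp]))
    have hb : b.degree = m := by
      rw [Finsupp.degree_eq_weight_one]
      exact hm (mem_support_iff.1 (by simp [hsupp]))
    omega
  obtain ⟨c, hc, hc0⟩ := (mem_vars_iff_mem_support 0).1 (hvars f hf hnh)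
  simp only [hsupp, Finset.mem_insert, Finset.mem_singleton] at hc
  rcases hc with rfl | rfl
  · exact Finsupp.mem_support_iff.1 hc0 ha0
  · exact Finsupp.mem_support_iff.1 hc0 hb0

/-- The binomials `x ^ a - x ^ r`, where `x ^ a` is a minimal generator of the ideal of leading
monomials and `r` is the least factorization of the value of `a`. -/
def reducedBasis (k : Type*) [Field k] (n : Fin (d + 1) → ℕ) :
    Set (MvPolynomial (Fin (d + 1)) k) :=
  {f | ∃ a r, Minimal (fun a => ¬ IsReduced n a) a ∧ IsReduced n r ∧ value n r = value n a ∧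
    f = binomial k a r}

lemma dsLT_of_isReduced {a r : Fin (d + 1) →₀ ℕ} (ha : ¬ IsReduced n a) (hr : IsReduced n r)
    (h : value n r = value n a) : dsLT r a := by
  rcases dsLT_trichotomy r a with h1 | rfl | h1
  · exact h1
  · exact absurd hr ha
  · exact absurd h1 (hr a h.symm)

lemma isBinomialSet_reducedBasis : IsBinomialSet (reducedBasis k n) := by
  rintro _ ⟨a, r, _, _, _, rfl⟩
  exact ⟨a, r, rfl⟩

lemma reducedBasis_subset :
    reducedBasis k n ⊆ (definingIdeal k n : Set (MvPolynomial (Fin (d + 1)) k)) := by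
  rintro _ ⟨a, r, _, _, h, rfl⟩
  exact binomial_mem_definingIdeal.2 h.symm

lemma isGroebnerBasis_reducedBasis (hpos : ∀ i, 0 < n i) :
    IsGroebnerBasis (definingIdeal k n) (reducedBasis k n) := by
  refine ⟨reducedBasis_subset, le_antisymm (Ideal.span_mono ?_) (Ideal.span_le.2 ?_)⟩
  · rintro g ⟨f, hf, c, hc⟩
    exact ⟨f, reducedBasis_subset hf, c, hc⟩
  · rintro _ ⟨f, hf, c, hc, rfl⟩
    obtain ⟨a, hac, ha⟩ := exists_minimal_le_of_wellFoundedLT (fun a => ¬ IsReduced n a) c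
      (not_isReduced_of_isLeadingExponent hf hc)
    obtain ⟨r, hr, hr'⟩ := exists_isReduced hpos a
    refine monomial_mem_leadingMonomialIdeal.2 ⟨_, ⟨a, r, ha, hr', hr, rfl⟩, a, ?_, hac⟩
    exact (isLeadingExponent_binomial (dsLT_of_isReduced ha.1 hr' hr)).2 rfl

lemma isMinimalGroebnerBasis_reducedBasis (hpos : ∀ i, 0 < n i) :
    IsMinimalGroebnerBasis (definingIdeal k n) (reducedBasis k n) := by
  refine ⟨isGroebnerBasis_reducedBasis hpos, fun G hG hle => ?_⟩
  rintro _ ⟨a, r, ha, hr, hv, rfl⟩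
  have hmem : monomial a (1 : k) ∈ leadingMonomialIdeal G := by
    rw [hG.2]
    exact monomial_mem_leadingMonomialIdeal_definingIdeal.2 ha.1
  obtain ⟨f, hf, c, hc, hca⟩ := monomial_mem_leadingMonomialIdeal.1 hmem
  obtain ⟨a', r', ha', hr', hv', rfl⟩ := hle hf
  rw [isLeadingExponent_binomial (dsLT_of_isReduced ha'.1 hr' hv')] at hc
  subst hc
  obtain rfl := le_antisymm hca (ha.2 ha'.1 hca)
  obtain rfl := hr.eq hr' (hv.trans hv'.symm)
  exact hf

/-- A minimal generator of the ideal of leading monomials is not divisible by the first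
variable. -/
lemma first_eq_zero_of_minimal (hn : FirstPreservesMaximality n) {a : Fin (d + 1) →₀ ℕ}
    (ha : Minimal (fun a => ¬ IsReduced n a) a) : a 0 = 0 := by
  by_contra h0
  obtain ⟨b, rfl⟩ := exists_eq_add_single h0
  have hb : IsReduced n b := by
    by_contra hb
    have := ha.2 hb le_self_add 0
    simp at this
  exact ha.1 (hb.add_single hn)

/-- If the value of `r` has some factorization involving the first generator, the least one
does. -/
lemma first_ne_zero_of_isReduced (hpos : ∀ i, 0 < n i) (hn : FirstPreservesMaximality n)
    {r c : Fin (d + 1) →₀ ℕ} (hr : IsReduced n r) (hc : value n c = value n r) (hc0 : c 0 ≠ 0) :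
    r 0 ≠ 0 := by
  obtain ⟨b, rfl⟩ := exists_eq_add_single hc0
  obtain ⟨t, ht, ht'⟩ := exists_isReduced hpos b
  have : r = t + Finsupp.single 0 1 :=
    hr.eq (ht'.add_single hn) (by rw [← hc, value_add, value_add, ht])
  simp [this]

lemma leading_first_eq_zero_reducedBasis (hn : FirstPreservesMaximality n) :
    ∀ f ∈ reducedBasis k n, ∀ c, IsLeadingExponent f c → c 0 = 0 := by
  rintro _ ⟨a, r, ha, hr, hv, rfl⟩ c hc
  rw [isLeadingExponent_binomial (dsLT_of_isReduced ha.1 hr hv)] at hc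
  rw [hc]
  exact first_eq_zero_of_minimal hn ha

lemma zero_mem_vars_reducedBasis (hpos : ∀ i, 0 < n i) (hh : LengthsForceFirst n)
    (hn : FirstPreservesMaximality n) :
    ∀ f ∈ reducedBasis k n, (¬ ∃ m, f.IsHomogeneous m) → 0 ∈ f.vars := by
  rintro _ ⟨a, r, ha, hr, hv, rfl⟩ hnh
  have hdeg : r.degree ≠ a.degree := fun h => hnh ⟨a.degree,
    (isHomogeneous_monomial 1 rfl).sub (isHomogeneous_monomial 1 h)⟩
  have hle := (isMaximalFactorization_iff n r).1 hr.isMaximalFactorization a hv.symm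
  obtain ⟨c, hc, hc0⟩ := hh r a hv (lt_of_le_of_ne hle hdeg.symm)
  have har : a ≠ r := by
    rintro rfl
    exact hdeg rfl
  refine (mem_vars_iff_mem_support 0).2 ⟨r, by simp [support_binomial har], ?_⟩
  exact Finsupp.mem_support_iff.2 (first_ne_zero_of_isReduced hpos hn hr hc hc0)

lemma exists_minimal_generating_subset {B : Set (MvPolynomial (Fin (d + 1)) k)} :
    ∃ E ⊆ B, IsMinimalGeneratingSet (Ideal.span B) E := by
  obtain ⟨T, hTB, hT⟩ := (Submodule.fg_span_iff_fg_span_finset_subset B).1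
    (IsNoetherian.noetherian (Ideal.span B))
  have hfin : {E | E ⊆ (T : Set (MvPolynomial (Fin (d + 1)) k)) ∧
      Ideal.span E = Ideal.span B}.Finite := T.finite_toSet.finite_subsets.subset fun _ h => h.1
  obtain ⟨E, hET, hE⟩ := hfin.exists_le_minimal (a := (T : Set _)) ⟨subset_rfl, hT.symm⟩
  exact ⟨E, hE.1.1.trans hTB, hE.1.2, fun F hF hFE => hE.2 ⟨hFE.trans hE.1.1, hF⟩ hFE⟩

end Groebner

/-! ### Powers of the maximal ideal and the Rees algebra -/

section Rees

variable (k : Type*) [Field k] {d : ℕ} (n : Fin (d + 1) → ℕ)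

/-- The generator `t ^ n_i` of the semigroup ring. -/
def gen (i : Fin (d + 1)) : semigroupRing k n :=
  ⟨Polynomial.X ^ n i, Algebra.subset_adjoin ⟨i, rfl⟩⟩

/-- The monomial `∏ (t ^ n_i) ^ a_i` of the semigroup ring. -/
def genPow (a : Fin (d + 1) →₀ ℕ) : semigroupRing k n := ∏ i, gen k n i ^ a i

lemma coe_genPow (a : Fin (d + 1) →₀ ℕ) :
    (genPow k n a : Polynomial k) = Polynomial.X ^ value n a := by
  have : ∀ i, ((gen k n i : semigroupRing k n) : Polynomial k) = Polynomial.X ^ n i :=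
    fun i => rfl
  rw [genPow, SubmonoidClass.coe_finsetProd, value]
  simp only [SubmonoidClass.coe_pow, this, ← pow_mul]
  rw [Finset.prod_pow_eq_pow_sum]
  simp only [mul_comm]

lemma genPow_add (a b : Fin (d + 1) →₀ ℕ) : genPow k n (a + b) = genPow k n a * genPow k n b := by
  simp only [genPow, Finsupp.add_apply, pow_add, Finset.prod_mul_distrib]

lemma gen_mem (i : Fin (d + 1)) : gen k n i ∈ semigroupRingIdeal k n :=
  Ideal.subset_span ⟨i, rfl⟩

lemma genPow_mem (a : Fin (d + 1) →₀ ℕ) : genPow k n a ∈ semigroupRingIdeal k n ^ a.degree := by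
  rw [Finsupp.degree_eq_sum, ← Finset.prod_pow_eq_pow_sum]
  exact Ideal.prod_mem_prod fun i _ => Ideal.pow_mem_pow (gen_mem k n i) _

lemma exists_value_eq_of_coeff_ne_zero (f : semigroupRing k n) (s : ℕ)
    (hs : (f : Polynomial k).coeff s ≠ 0) : ∃ a, value n a = s := by
  obtain ⟨f, hf⟩ := f
  induction hf using Algebra.adjoin_induction generalizing s with
  | mem f hf =>
    obtain ⟨i, rfl⟩ := hf
    refine ⟨Finsupp.single i 1, ?_⟩
    simp only [Polynomial.coeff_X_pow, ne_eq, ite_eq_right_iff, not_forall] at hs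
    rw [value_single, one_mul, hs.1]
  | algebraMap r =>
    refine ⟨0, ?_⟩
    rw [value_zero]
    by_contra h
    exact hs (by simp [Polynomial.algebraMap_eq, Polynomial.coeff_C, Ne.symm h])
  | add f g _ _ hf hg =>
    simp only [Polynomial.coeff_add] at hs
    by_cases h : f.coeff s = 0
    · exact hg s (by rwa [h, zero_add] at hs)
    · exact hf s h
  | mul f g _ _ hf hg =>
    simp only [Polynomial.coeff_mul] at hs
    obtain ⟨⟨u, v⟩, huv, h⟩ := Finset.exists_ne_zero_of_sum_ne_zero hs
    obtain ⟨a, rfl⟩ := hf u (left_ne_zero_of_mul h)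
    obtain ⟨b, rfl⟩ := hg v (right_ne_zero_of_mul h)
    exact ⟨a + b, by rw [value_add]; exact Finset.HasAntidiagonal.mem_antidiagonal.1 huv⟩

/-- The elements of the semigroup ring all of whose exponents have factorizations of length at
least `j`; this ideal turns out to be the `j`-th power of the maximal ideal. -/
def lengthIdeal (j : ℕ) : Ideal (semigroupRing k n) where
  carrier := {f | ∀ s, (f : Polynomial k).coeff s ≠ 0 → ∃ a, value n a = s ∧ j ≤ a.degree}
  zero_mem' := by
    intro s hs
    simp at hs
  add_mem' := by
    intro f g hf hg s hs
    simp only [Subalgebra.coe_add, Polynomial.coeff_add] at hs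
    by_cases h : (f : Polynomial k).coeff s = 0
    · exact hg s (by rwa [h, zero_add] at hs)
    · exact hf s h
  smul_mem' := by
    intro f g hg s hs
    simp only [smul_eq_mul, Subalgebra.coe_mul, Polynomial.coeff_mul] at hs
    obtain ⟨⟨u, v⟩, huv, h⟩ := Finset.exists_ne_zero_of_sum_ne_zero hs
    obtain ⟨a, rfl⟩ := exists_value_eq_of_coeff_ne_zero k n f u (left_ne_zero_of_mul h)
    obtain ⟨b, rfl, hb⟩ := hg v (right_ne_zero_of_mul h)
    exact ⟨a + b, by rw [value_add]; exact Finset.HasAntidiagonal.mem_antidiagonal.1 huv,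
      by rw [map_add]; omega⟩

lemma pow_le_lengthIdeal (j : ℕ) : semigroupRingIdeal k n ^ j ≤ lengthIdeal k n j := by
  induction j with
  | zero =>
    intro f _ s hs
    obtain ⟨a, ha⟩ := exists_value_eq_of_coeff_ne_zero k n f s hs
    exact ⟨a, ha, Nat.zero_le _⟩
  | succ j ih =>
    have h1 : semigroupRingIdeal k n ≤ lengthIdeal k n 1 := by
      refine Ideal.span_le.2 ?_
      rintro f ⟨i, hi⟩ s hs
      refine ⟨Finsupp.single i 1, ?_, by rw [Finsupp.degree_single]⟩
      rw [hi] at hs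
      simp only [Polynomial.coeff_X_pow, ne_eq, ite_eq_right_iff, not_forall] at hs
      rw [value_single, one_mul, hs.1]
    rw [pow_succ]
    refine Ideal.mul_le.2 fun f hf g hg s hs => ?_
    simp only [Subalgebra.coe_mul, Polynomial.coeff_mul] at hs
    obtain ⟨⟨u, v⟩, huv, h⟩ := Finset.exists_ne_zero_of_sum_ne_zero hs
    obtain ⟨a, rfl, ha⟩ := ih hf u (left_ne_zero_of_mul h)
    obtain ⟨b, rfl, hb⟩ := h1 hg v (right_ne_zero_of_mul h)
    exact ⟨a + b, by rw [value_add]; exact Finset.HasAntidiagonal.mem_antidiagonal.1 huv,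
      by rw [map_add]; omega⟩

/-- The Rees algebra of the maximal ideal of the semigroup ring. -/
abbrev Rees : Type _ := reesAlgebra (semigroupRingIdeal k n)

/-- The ideal of the Rees algebra generated by the maximal ideal. -/
abbrev reesIdeal : Ideal (Rees k n) :=
  (semigroupRingIdeal k n).map (algebraMap (semigroupRing k n) (Rees k n))

variable {k n}

/-- The coefficient of `t ^ s T ^ j` of an element of the Rees algebra `R[IT]`. -/
def reesCoeff (j s : ℕ) (F : Rees k n) : k :=
  ((F : Polynomial (semigroupRing k n)).coeff j : Polynomial k).coeff s

lemma reesCoeff_apply (j s : ℕ) (F : Rees k n) : reesCoeff j s F =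
    ((F : Polynomial (semigroupRing k n)).coeff j : Polynomial k).coeff s := rfl

lemma reesCoeff_smul (j s : ℕ) (c : k) (F : Rees k n) :
    reesCoeff j s (c • F) = c * reesCoeff j s F := by
  change (((c • (F : Polynomial (semigroupRing k n))).coeff j : semigroupRing k n) :
    Polynomial k).coeff s = _
  rw [Polynomial.coeff_smul]
  simp [reesCoeff_apply]

lemma reesCoeff_sum {ι : Type*} (T : Finset ι) (j s : ℕ) (F : ι → Rees k n) :
    reesCoeff j s (∑ i ∈ T, F i) = ∑ i ∈ T, reesCoeff j s (F i) := by
  simp only [reesCoeff_apply, AddSubmonoidClass.coe_finsetSum, Polynomial.finsetSum_coeff]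

lemma rees_ext {F G : Rees k n} (h : ∀ j s, reesCoeff j s F = reesCoeff j s G) : F = G := by
  ext j s
  exact h j s

lemma exists_of_reesCoeff_ne_zero {F : Rees k n} {j s : ℕ} (h : reesCoeff j s F ≠ 0) :
    ∃ a, value n a = s ∧ j ≤ a.degree :=
  pow_le_lengthIdeal k n j (F.2 j) s h

lemma reesCoeff_smul_mul (j s : ℕ) (c : k) (F G : Rees k n) :
    reesCoeff j s (c • F * G) = c * reesCoeff j s (F * G) := by
  rw [smul_mul_assoc, reesCoeff_smul]

variable (k n)

/-- The element `t ^ s T ^ j` of the Rees algebra, where `s` is the value of a factorization `a`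
of length at least `j`. -/
def reesMonomial (j : ℕ) (a : Fin (d + 1) →₀ ℕ) (h : j ≤ a.degree) : Rees k n :=
  ⟨Polynomial.monomial j (genPow k n a),
    reesAlgebra.monomial_mem.2 (Ideal.pow_le_pow_right h (genPow_mem k n a))⟩

/-- The element `t ^ (value a) T ^ |a|` of the Rees algebra, the product of the `t ^ n_i T` with
exponents `a_i`. -/
def reesPow (a : Fin (d + 1) →₀ ℕ) : Rees k n := reesMonomial k n a.degree a le_rfl

variable {k n}

lemma reesCoeff_reesMonomial {i : ℕ} {a : Fin (d + 1) →₀ ℕ} (h : i ≤ a.degree) (j s : ℕ) :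
    reesCoeff j s (reesMonomial k n i a h) = if i = j ∧ value n a = s then 1 else 0 := by
  rw [reesCoeff_apply, reesMonomial, Polynomial.coeff_monomial]
  by_cases hij : i = j
  · simp only [hij, if_true, true_and, coe_genPow, Polynomial.coeff_X_pow, eq_comm]
  · simp [hij]

lemma finite_reesCoeff_ne_zero (F : Rees k n) :
    {p : ℕ × ℕ | reesCoeff p.1 p.2 F ≠ 0}.Finite := by
  refine ((F : Polynomial (semigroupRing k n)).support.finite_toSet.biUnion
    (t := fun j => Prod.mk j '' (((F : Polynomial (semigroupRing k n)).coeff j :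
      Polynomial k).support : Set ℕ)) fun j _ => (Finset.finite_toSet _).image _).subset ?_
  rintro ⟨j, s⟩ h0
  simp only [Set.mem_iUnion]
  refine ⟨j, ?_, s, Polynomial.mem_support_iff.2 h0, rfl⟩
  refine Polynomial.mem_support_iff.2 fun hj => h0 ?_
  rw [reesCoeff_apply, hj]
  simp

lemma reesCoeff_sum_smul (T : Finset (ℕ × ℕ)) (c : ℕ × ℕ → k) (M : ℕ × ℕ → Rees k n)
    (hM : ∀ p ∈ T, ∃ a h, value n a = p.2 ∧ M p = reesMonomial k n p.1 a h) (j s : ℕ) :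
    reesCoeff j s (∑ p ∈ T, c p • M p) = if (j, s) ∈ T then c (j, s) else 0 := by
  have hM' : ∀ p ∈ T, reesCoeff j s (c p • M p) = if p = (j, s) then c (j, s) else 0 := by
    rintro ⟨i, u⟩ hp
    obtain ⟨a, h, ha, hMa⟩ := hM _ hp
    dsimp only at ha hMa
    rw [reesCoeff_smul, hMa, reesCoeff_reesMonomial, ha]
    by_cases hh : i = j ∧ u = s
    · rw [if_pos hh, if_pos (by rw [hh.1, hh.2]), hh.1, hh.2, mul_one]
    · rw [if_neg hh, if_neg (fun h => hh (Prod.mk.inj h)), mul_zero]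
  rw [reesCoeff_sum, Finset.sum_congr rfl hM', Finset.sum_ite_eq']

/-- The Rees algebra is spanned by the monomials `t ^ s T ^ j`. -/
lemma mem_of_reesMonomial_mem (L : Submodule k (Rees k n)) (F : Rees k n)
    (h : ∀ j a (hj : j ≤ a.degree), reesCoeff j (value n a) F ≠ 0 → reesMonomial k n j a hj ∈ L) :
    F ∈ L := by
  have hT : ∀ j s, (j, s) ∈ (finite_reesCoeff_ne_zero F).toFinset ↔ reesCoeff j s F ≠ 0 :=
    fun j s => Set.Finite.mem_toFinset _
  have hM : ∀ p : ℕ × ℕ, ∃ x : Rees k n, p ∈ (finite_reesCoeff_ne_zero F).toFinset →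
      x ∈ L ∧ ∃ a h, value n a = p.2 ∧ x = reesMonomial k n p.1 a h := by
    rintro ⟨j, s⟩
    by_cases h0 : reesCoeff j s F = 0
    · exact ⟨0, fun hp => absurd h0 ((hT j s).1 hp)⟩
    · obtain ⟨a, rfl, ha⟩ := exists_of_reesCoeff_ne_zero h0
      exact ⟨reesMonomial k n j a ha, fun _ => ⟨h j a ha h0, a, ha, rfl, rfl⟩⟩
  choose M hM using hM
  obtain ⟨c, hc⟩ : ∃ c : ℕ × ℕ → k, ∀ j s, c (j, s) = reesCoeff j s F :=
    ⟨fun p => reesCoeff p.1 p.2 F, fun _ _ => rfl⟩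
  have hF : F = ∑ p ∈ (finite_reesCoeff_ne_zero F).toFinset, c p • M p := by
    refine rees_ext fun j s => ?_
    rw [reesCoeff_sum_smul _ c M fun p hp => (hM p hp).2, hc]
    by_cases h0 : reesCoeff j s F = 0
    · rw [if_neg fun hp => (hT j s).1 hp h0, h0]
    · rw [if_pos ((hT j s).2 h0)]
  rw [hF]
  exact L.sum_mem fun p hp => L.smul_mem _ (hM p hp).1

lemma reesMonomial_mem_reesIdeal {j : ℕ} {a : Fin (d + 1) →₀ ℕ} (h : j ≤ a.degree)
    (h' : j < a.degree) : reesMonomial k n j a h ∈ reesIdeal k n := by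
  obtain ⟨i, hi⟩ : ∃ i, a i ≠ 0 := by
    by_contra! h0
    have : a = 0 := Finsupp.ext h0
    rw [this, map_zero] at h'
    omega
  obtain ⟨b, rfl⟩ := exists_eq_add_single hi
  rw [degree_add_single] at h'
  have : reesMonomial k n j (b + Finsupp.single i 1) h =
      algebraMap (semigroupRing k n) (Rees k n) (genPow k n (Finsupp.single i 1)) *
        reesMonomial k n j b (by omega) := by
    apply Subtype.ext
    change Polynomial.monomial j _ = Polynomial.C _ * Polynomial.monomial j _
    rw [Polynomial.C_mul_monomial, genPow_add, mul_comm]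
  rw [this]
  refine Ideal.mul_mem_right _ _ (Ideal.mem_map_of_mem _ ?_)
  have := genPow_mem k n (Finsupp.single i 1)
  rwa [Finsupp.degree_single, pow_one] at this

lemma mem_reesIdeal_iff {F : Rees k n} : F ∈ reesIdeal k n ↔
    ∀ j s, reesCoeff j s F ≠ 0 → ∃ a, value n a = s ∧ j < a.degree := by
  constructor
  · intro hF
    let L : Ideal (Rees k n) :=
      { carrier := {F | ∀ j, (F : Polynomial (semigroupRing k n)).coeff j ∈
          semigroupRingIdeal k n ^ (j + 1)}
        zero_mem' := fun j => by simp
        add_mem' := fun {F G} hF hG j => by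
          simp only [Subalgebra.coe_add, Polynomial.coeff_add]
          exact Ideal.add_mem _ (hF j) (hG j)
        smul_mem' := fun F G hG j => by
          simp only [smul_eq_mul, Subalgebra.coe_mul, Polynomial.coeff_mul]
          refine Ideal.sum_mem _ fun p hp => ?_
          rw [← Finset.HasAntidiagonal.mem_antidiagonal.1 hp, add_assoc, pow_add]
          exact Ideal.mul_mem_mul (F.2 p.1) (hG p.2) }
    have hle : reesIdeal k n ≤ L := by
      refine Ideal.map_le_iff_le_comap.2 fun r hr j => ?_
      change (Polynomial.C r).coeff j ∈ _
      rw [Polynomial.coeff_C]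
      split_ifs with hj
      · rwa [hj, zero_add, pow_one]
      · exact Ideal.zero_mem _
    exact fun j s h => pow_le_lengthIdeal k n (j + 1) (hle hF j) s h
  · intro h
    refine mem_of_reesMonomial_mem ((reesIdeal k n).restrictScalars k) F fun j a hj h0 => ?_
    obtain ⟨b, hb, hlt⟩ := h j _ h0
    have : reesMonomial k n j a hj = reesMonomial k n j b hlt.le :=
      rees_ext fun i u => by rw [reesCoeff_reesMonomial, reesCoeff_reesMonomial, hb]
    rw [this]
    exact reesMonomial_mem_reesIdeal hlt.le hlt

lemma reesPow_mem_reesIdeal_iff {a : Fin (d + 1) →₀ ℕ} :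
    reesPow k n a ∈ reesIdeal k n ↔ ¬ IsMaximalFactorization n a := by
  rw [mem_reesIdeal_iff, not_isMaximalFactorization_iff]
  simp only [reesPow, reesCoeff_reesMonomial]
  constructor
  · intro h
    exact h a.degree (value n a) (by simp)
  · rintro h j s h0
    simp only [ne_eq, ite_eq_right_iff, not_forall] at h0
    obtain ⟨⟨rfl, rfl⟩, _⟩ := h0
    exact h

lemma reesPow_add (a b : Fin (d + 1) →₀ ℕ) :
    reesPow k n (a + b) = reesPow k n a * reesPow k n b := by
  apply Subtype.ext
  change Polynomial.monomial _ _ = Polynomial.monomial _ _ * Polynomial.monomial _ _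
  rw [Polynomial.monomial_mul_monomial, genPow_add, map_add]

lemma reesPow_zero : reesPow k n 0 = 1 := by
  apply Subtype.ext
  change Polynomial.monomial _ _ = _
  rw [map_zero]
  simp [genPow]

lemma reesPow_single (i : Fin (d + 1)) (m : ℕ) :
    reesPow k n (Finsupp.single i m) = reesPow k n (Finsupp.single i 1) ^ m := by
  induction m with
  | zero => rw [Finsupp.single_zero, reesPow_zero, pow_zero]
  | succ m ih => rw [Finsupp.single_add, reesPow_add, ih, pow_succ]

lemma reesCoeff_reesPow_mul (a : Fin (d + 1) →₀ ℕ) (F : Rees k n) (j s : ℕ) :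
    reesCoeff (j + a.degree) (s + value n a) (reesPow k n a * F) = reesCoeff j s F := by
  rw [mul_comm, reesCoeff_apply, reesCoeff_apply]
  change (((F : Polynomial (semigroupRing k n)) * Polynomial.monomial a.degree (genPow k n a)).coeff
    (j + a.degree) : Polynomial k).coeff _ = _
  rw [Polynomial.coeff_mul_monomial, Subalgebra.coe_mul, coe_genPow, Polynomial.coeff_mul_X_pow]

lemma exists_of_reesCoeff_reesPow_mul_ne_zero {a : Fin (d + 1) →₀ ℕ} {F : Rees k n} {j s : ℕ}
    (h : reesCoeff j s (reesPow k n a * F) ≠ 0) :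
    ∃ i u, j = i + a.degree ∧ s = u + value n a ∧ reesCoeff i u F ≠ 0 := by
  have hj : a.degree ≤ j := by
    by_contra! hlt
    apply h
    rw [mul_comm, reesCoeff_apply]
    change (((F : Polynomial (semigroupRing k n)) *
      Polynomial.monomial a.degree (genPow k n a)).coeff j : Polynomial k).coeff _ = _
    rw [← Polynomial.C_mul_X_pow_eq_monomial, ← mul_assoc, Polynomial.coeff_mul_X_pow',
      if_neg (not_le.2 hlt)]
    simp
  obtain ⟨i, rfl⟩ := Nat.exists_eq_add_of_le' hj
  have hs : value n a ≤ s := by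
    by_contra! hlt
    apply h
    rw [mul_comm, reesCoeff_apply]
    change (((F : Polynomial (semigroupRing k n)) *
      Polynomial.monomial a.degree (genPow k n a)).coeff (i + a.degree) : Polynomial k).coeff _ = _
    rw [Polynomial.coeff_mul_monomial, Subalgebra.coe_mul, coe_genPow, Polynomial.coeff_mul_X_pow',
      if_neg (not_le.2 hlt)]
  obtain ⟨u, rfl⟩ := Nat.exists_eq_add_of_le' hs
  exact ⟨i, u, rfl, rfl, by rwa [reesCoeff_reesPow_mul] at h⟩

/-- If adding the first generator preserves maximality, then every nonzero polynomial in the class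
of the first variable is a nonzerodivisor on the tangent cone: its leading term acts without
cancellation on the part of highest degree. -/
lemma mem_reesIdeal_of_aeval_mul_mem (hn : FirstPreservesMaximality n)
    {p : Polynomial k} (hp : p ≠ 0) {F : Rees k n}
    (h : Polynomial.aeval (reesPow k n (Finsupp.single 0 1)) p * F ∈ reesIdeal k n) :
    F ∈ reesIdeal k n := by
  by_contra hF
  rw [mem_reesIdeal_iff] at hF
  push Not at hF
  let Q : ℕ → Prop := fun j => ∃ a, IsMaximalFactorization n a ∧ a.degree = j ∧
    reesCoeff j (value n a) F ≠ 0
  have hQ : ∃ j, Q j := by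
    obtain ⟨j, s, h0, hmax⟩ := hF
    obtain ⟨a, rfl, hj⟩ := exists_of_reesCoeff_ne_zero h0
    have hj' := le_antisymm hj (hmax a rfl)
    refine ⟨j, a, (isMaximalFactorization_iff n a).2 fun b hb => ?_, hj'.symm, h0⟩
    rw [← hj']
    exact hmax b hb
  have hbound : ∀ j, Q j → j ≤ (F : Polynomial (semigroupRing k n)).natDegree := by
    rintro j ⟨a, _, _, h0⟩
    refine Polynomial.le_natDegree_of_ne_zero fun hj => h0 ?_
    rw [reesCoeff_apply, hj]
    simp
  obtain ⟨j, hj, hjmax⟩ : ∃ j, Q j ∧ ∀ i, Q i → i ≤ j := by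
    obtain ⟨j₀, hj₀⟩ := hQ
    classical
    exact ⟨Nat.findGreatest Q _, Nat.findGreatest_spec (hbound _ hj₀) hj₀,
      fun i hi => Nat.le_findGreatest (hbound i hi) hi⟩
  obtain ⟨a, hamax, rfl, h0⟩ := hj
  set m := p.natDegree
  have htop : reesCoeff (a.degree + m) (value n a + m * n 0)
      (Polynomial.aeval (reesPow k n (Finsupp.single 0 1)) p * F) =
        p.leadingCoeff * reesCoeff a.degree (value n a) F := by
    rw [Polynomial.aeval_eq_sum_range, Finset.sum_mul, reesCoeff_sum]
    rw [Finset.sum_eq_single m]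
    · rw [reesCoeff_smul_mul, ← reesPow_single]
      have := reesCoeff_reesPow_mul (Finsupp.single 0 m) F a.degree (value n a)
      rw [Finsupp.degree_single, value_single] at this
      rw [this, Polynomial.leadingCoeff]
    · intro i hi him
      rw [reesCoeff_smul_mul, ← reesPow_single]
      obtain ⟨l, hl⟩ := Nat.exists_eq_add_of_le (Nat.lt_succ_iff.1 (Finset.mem_range.1 hi))
      have := reesCoeff_reesPow_mul (Finsupp.single 0 i) F (a + Finsupp.single 0 l).degree
        (value n (a + Finsupp.single 0 l))
      rw [Finsupp.degree_single, value_single, map_add, Finsupp.degree_single, value_add,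
        value_single, add_assoc, add_assoc, ← add_mul, add_comm l i, ← hl] at this
      rw [this]
      by_contra hne
      have hQl : Q (a.degree + l) := by
        refine ⟨a + Finsupp.single 0 l, hn.add_single hamax l, ?_, ?_⟩
        · rw [map_add, Finsupp.degree_single]
        · rw [value_add, value_single]
          exact right_ne_zero_of_mul hne
      have := hjmax _ hQl
      omega
    · intro hmr
      exact absurd (Finset.mem_range.2 (Nat.lt_succ_self m)) hmr
  rw [mem_reesIdeal_iff] at h
  obtain ⟨b, hb, hlt⟩ := h (a.degree + m) (value n a + m * n 0) (by
    rw [htop]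
    exact mul_ne_zero (Polynomial.leadingCoeff_ne_zero.2 hp) h0)
  have := (isMaximalFactorization_iff n _).1 (hn.add_single hamax m) b
    (by rw [hb, value_add, value_single])
  rw [map_add, Finsupp.degree_single] at this
  omega

end Rees

/-! ### Cohen-Macaulay algebras generated by one element modulo nilpotents -/

section OneDimensional

variable {k : Type*} [Field k] {A : Type*} [CommRing A] [Algebra k A] {x : A}

lemma ringKrullDim_le_one_of_generated
    (hgen : ∀ g : A, ∃ p : Polynomial k, g - Polynomial.aeval x p ∈ nilradical A) :
    ringKrullDim A ≤ 1 := by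
  have h1 : ringKrullDim A = ringKrullDim (A ⧸ nilradical A) := by
    rw [ringKrullDim_quotient]
    have : PrimeSpectrum.zeroLocus (R := A) (nilradical A) = Set.univ :=
      Set.eq_univ_of_forall fun p => nilradical_le_prime p.asIdeal
    rw [this]
    exact (Order.krullDim_eq_of_orderIso OrderIso.Set.univ).symm
  rw [h1]
  have h2 := ringKrullDim_le_of_surjective
    ((Ideal.Quotient.mk (nilradical A)).comp (Polynomial.aeval (R := k) x).toRingHom) (by
    intro g
    obtain ⟨g, rfl⟩ := Ideal.Quotient.mk_surjective g
    obtain ⟨p, hp⟩ := hgen g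
    exact ⟨p, (Ideal.Quotient.eq.2 hp).symm⟩)
  refine h2.trans ?_
  rw [Polynomial.ringKrullDim_of_isNoetherianRing, ringKrullDim_eq_zero_of_field, zero_add]

/-- The residue fields are quotients of `k[X]`, so every maximal ideal contains a nonzero
polynomial in the generator. -/
lemma exists_aeval_mem_of_isMaximal
    (hgen : ∀ g : A, ∃ p : Polynomial k, g - Polynomial.aeval x p ∈ nilradical A)
    (M : Ideal A) [M.IsMaximal] : ∃ p : Polynomial k, p ≠ 0 ∧ Polynomial.aeval x p ∈ M := by
  by_contra! hno
  let φ : Polynomial k →+* A ⧸ M :=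
    (Ideal.Quotient.mk M).comp (Polynomial.aeval (R := k) x).toRingHom
  have hinj : Function.Injective φ := by
    rw [injective_iff_map_eq_zero]
    intro p hp
    by_contra hp0
    exact hno p hp0 (Ideal.Quotient.eq_zero_iff_mem.1 hp)
  have hsurj : Function.Surjective φ := by
    intro g
    obtain ⟨g, rfl⟩ := Ideal.Quotient.mk_surjective g
    obtain ⟨p, hp⟩ := hgen g
    exact ⟨p, (Ideal.Quotient.eq.2 (nilradical_le_prime M hp)).symm⟩
  have hfield := (RingEquiv.ofBijective φ ⟨hinj, hsurj⟩).toMulEquiv.isField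
    ((Ideal.Quotient.maximal_ideal_iff_isField_quotient M).1 inferInstance)
  exact Polynomial.not_isField k hfield

lemma isCohenMacaulay_of_aeval_mem_nonZeroDivisors [IsNoetherianRing A]
    (hgen : ∀ g : A, ∃ p : Polynomial k, g - Polynomial.aeval x p ∈ nilradical A)
    (hnzd : ∀ p : Polynomial k, p ≠ 0 → Polynomial.aeval x p ∈ nonZeroDivisors A) :
    IsCohenMacaulay A := by
  refine ⟨inferInstance, fun M hM => ?_⟩
  obtain ⟨p, hp, hpM⟩ := exists_aeval_mem_of_isMaximal hgen M
  have hnzd := hnzd p hp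
  set r := Polynomial.aeval x p
  have hmem : algebraMap _ (Localization.AtPrime M) r ∈
      IsLocalRing.maximalIdeal (Localization.AtPrime M) :=
    (IsLocalization.AtPrime.to_map_mem_maximal_iff _ M r).2 hpM
  have hnzd' : algebraMap _ (Localization.AtPrime M) r ∈
      nonZeroDivisors (Localization.AtPrime M) :=
    IsLocalization.map_nonZeroDivisors_le M.primeCompl _ (Submonoid.mem_map_of_mem _ hnzd)
  have hmem' : ∀ y ∈ [algebraMap _ (Localization.AtPrime M) r],
      y ∈ IsLocalRing.maximalIdeal (Localization.AtPrime M) := fun y hy => by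
    rwa [List.mem_singleton.1 hy]
  refine ⟨[algebraMap _ (Localization.AtPrime M) r], hmem', ?_, ?_⟩
  · rw [IsLocalRing.isRegular_iff_isWeaklyRegular_of_subset_maximalIdeal hmem',
      RingTheory.Sequence.isWeaklyRegular_singleton_iff]
    intro y z hyz
    exact (mul_cancel_left_mem_nonZeroDivisors hnzd').1 hyz
  · rw [IsLocalization.AtPrime.ringKrullDim_eq_height M]
    refine le_antisymm ?_ ?_
    · have h0 : M.height ≠ 0 := by
        rw [Ne, Ideal.height_eq_zero_iff]
        intro hmin
        exact Set.disjoint_iff.mp (Ideal.disjoint_nonZeroDivisors_of_mem_minimalPrimes hmin)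
          ⟨hpM, hnzd⟩
      have h1 : 1 ≤ M.height := Order.one_le_iff_pos.2 (pos_iff_ne_zero.2 h0)
      simpa using WithBot.coe_le_coe.2 h1
    · simpa using (Ideal.height_le_ringKrullDim_of_ne_top (Ideal.IsMaximal.ne_top hM)).trans
        (ringKrullDim_le_one_of_generated hgen)

/-- A nonzero element annihilated by a maximal ideal prevents full depth there, unless the
localization has dimension zero. -/
lemma not_hasFullDepth_of_socle {A : Type*} [CommRing A] (M : Ideal A) [hM : M.IsMaximal] {z x : A}
    (hz : z ≠ 0) (hsocle : ∀ g ∈ M, g * z = 0) (hx : x ∈ M)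
    (hxpow : ∀ u m, u * x ^ m = 0 → u ∈ M) : ¬ HasFullDepth (Localization.AtPrime M) := by
  -- the socle element survives in the localization, its annihilator being `M`
  have hz' : algebraMap A (Localization.AtPrime M) z ≠ 0 := by
    intro h0
    obtain ⟨⟨u, hu⟩, hu0⟩ := (IsLocalization.map_eq_zero_iff M.primeCompl _ _).1 h0
    obtain ⟨v, w, hw, hvw⟩ := hM.exists_inv hu
    apply hz
    rw [← one_mul z, ← hvw, add_mul, hsocle w hw, add_zero, mul_assoc]
    exact (congrArg (v * ·) hu0).trans (mul_zero v)
  rintro ⟨rs, hmem, hreg, hlen⟩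
  cases rs with
  | nil =>
    -- in dimension zero some power of `x` would vanish near `M`
    have hdim : Ring.KrullDimLE 0 (Localization.AtPrime M) := by
      rw [Ring.krullDimLE_iff, ← hlen]
      simp
    have hx' : algebraMap _ (Localization.AtPrime M) x ∈
        IsLocalRing.maximalIdeal (Localization.AtPrime M) :=
      (IsLocalization.AtPrime.to_map_mem_maximal_iff _ M x).2 hx
    rw [← Ring.KrullDimLE.nilradical_eq_maximalIdeal] at hx'
    obtain ⟨m, hm⟩ := hx'
    rw [← map_pow] at hm
    obtain ⟨⟨u, hu⟩, hu0⟩ := (IsLocalization.map_eq_zero_iff M.primeCompl _ _).1 hm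
    exact hu (hxpow u m hu0)
  | cons r rs =>
    have hr := hmem r (by simp)
    have hsm := ((RingTheory.Sequence.isWeaklyRegular_cons_iff _ r rs).1 hreg.1).1
    obtain ⟨g, u, rfl⟩ := IsLocalization.exists_mk'_eq M.primeCompl r
    rw [IsLocalization.AtPrime.mk'_mem_maximal_iff (Localization.AtPrime M) M] at hr
    have h0 : IsLocalization.mk' (Localization.AtPrime M) g u *
        algebraMap _ (Localization.AtPrime M) z = 0 := by
      rw [mul_comm, IsLocalization.mul_mk'_eq_mk'_of_mul, mul_comm, hsocle g hr,
        IsLocalization.mk'_zero]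
    exact hz' (hsm (by simpa using h0))

end OneDimensional

/-! ### The tangent cone -/

section TangentCone

variable {k : Type*} [Field k] {d : ℕ} {n : Fin (d + 1) → ℕ}

/-- If adding the first generator does not preserve maximality, there is a maximal factorization
that stays maximal under the addition of no generator: the exponents of the other variables are
bounded, so a longest extension of a bad maximal factorization exists. -/
lemma exists_socle_factorization (hlt : ∀ i, i ≠ 0 → n 0 < n i)
    (hn : ¬ FirstPreservesMaximality n) : ∃ c, IsMaximalFactorization n c ∧
      ∀ i, ¬ IsMaximalFactorization n (c + Finsupp.single i 1) := by
  rw [FirstPreservesMaximality] at hn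
  push Not at hn
  obtain ⟨a, ha, ha'⟩ := hn
  have hfin : {b | IsMaximalFactorization n (a + b)}.Finite := by
    refine (Set.finite_Iic (Finsupp.equivFunOnFinite.symm fun _ : Fin (d + 1) => n 0)).subset ?_
    intro b hb i
    rw [Finsupp.equivFunOnFinite_symm_apply_apply]
    by_contra! hi
    by_cases h0 : i = 0
    · subst h0
      obtain ⟨e, rfl⟩ := exists_eq_add_single (a := b) (i := 0) (by omega)
      have hb' : IsMaximalFactorization n (a + (e + Finsupp.single 0 1)) := hb
      rw [add_comm e, ← add_assoc] at hb'
      exact ha' hb'.of_add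
    · obtain ⟨c, rfl⟩ := exists_add_of_le (Finsupp.single_le_iff.2 hi.le)
      have hb' : IsMaximalFactorization n (a + (Finsupp.single i (n 0) + c)) := hb
      rw [add_left_comm] at hb'
      exact not_isMaximalFactorization_single hlt h0 hb'.of_add
  obtain ⟨b, hb, hmax⟩ := Set.exists_max_image _ Finsupp.degree hfin ⟨0, by simpa using ha⟩
  refine ⟨a + b, hb, fun i hi => ?_⟩
  rw [add_assoc] at hi
  have := hmax _ hi
  rw [degree_add_single] at this
  omega

lemma isNoetherianRing_rees : IsNoetherianRing (Rees k n) := by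
  have : Algebra.FiniteType k (semigroupRing k n) :=
    (Subalgebra.fg_iff_finiteType _).1
      (Subalgebra.fg_def.2 ⟨_, Set.finite_range _, rfl⟩)
  have : IsNoetherianRing (semigroupRing k n) := Algebra.FiniteType.isNoetherianRing k _
  infer_instance

/-- The augmentation of the Rees algebra, the coefficient of `t ^ 0 T ^ 0`. -/
def augmentation (k : Type*) [Field k] (n : Fin (d + 1) → ℕ) : Rees k n →+* k where
  toFun := reesCoeff 0 0
  map_one' := by simp [reesCoeff_apply]
  map_mul' F G := by simp [reesCoeff_apply, Polynomial.mul_coeff_zero]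
  map_zero' := by simp [reesCoeff_apply]
  map_add' F G := by simp [reesCoeff_apply]

lemma augmentation_apply (F : Rees k n) : augmentation k n F = reesCoeff 0 0 F := rfl

lemma augmentation_surjective : Function.Surjective (augmentation k n) := by
  intro c
  refine ⟨c • (1 : Rees k n), ?_⟩
  rw [augmentation_apply, reesCoeff_smul, reesCoeff_apply]
  simp

lemma reesIdeal_le_ker_augmentation (hpos : ∀ i, 0 < n i) :
    reesIdeal k n ≤ RingHom.ker (augmentation k n) := by
  intro F hF
  rw [RingHom.mem_ker, augmentation_apply]
  by_contra h0
  obtain ⟨a, ha, hlt⟩ := mem_reesIdeal_iff.1 hF 0 0 h0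
  have := degree_le_value hpos a
  omega

/-- A factorization that stays maximal under the addition of no generator gives an element of the
tangent cone annihilated by the whole irrelevant ideal. -/
lemma mul_reesPow_mem_reesIdeal {c : Fin (d + 1) →₀ ℕ}
    (hc : ∀ i, ¬ IsMaximalFactorization n (c + Finsupp.single i 1)) {F : Rees k n}
    (hF : F ∈ RingHom.ker (augmentation k n)) : F * reesPow k n c ∈ reesIdeal k n := by
  rw [RingHom.mem_ker, augmentation_apply] at hF
  rw [mul_comm, mem_reesIdeal_iff]
  intro j s h0
  obtain ⟨i, u, rfl, rfl, h1⟩ := exists_of_reesCoeff_reesPow_mul_ne_zero h0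
  obtain ⟨a, rfl, ha⟩ := exists_of_reesCoeff_ne_zero h1
  have ha0 : a ≠ 0 := by
    rintro rfl
    rw [map_zero, Nat.le_zero] at ha
    rw [ha, value_zero] at h1
    exact h1 hF
  obtain ⟨l, hl⟩ := Finsupp.ne_iff.1 ha0
  obtain ⟨b, rfl⟩ := exists_eq_add_single hl
  have hnot : ¬ IsMaximalFactorization n ((c + Finsupp.single l 1) + b) :=
    fun h => hc l h.of_add
  obtain ⟨e, he, hlt⟩ := (not_isMaximalFactorization_iff n _).1 hnot
  refine ⟨e, ?_, ?_⟩
  · rw [he]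
    simp only [value_add]
    ring
  · simp only [map_add] at hlt ha
    omega

/-- No power of the first variable vanishes near the irrelevant ideal. -/
lemma mem_ker_augmentation_of_mul_pow_mem (hpos : ∀ i, 0 < n i) (hlt : ∀ i, i ≠ 0 → n 0 < n i)
    {F : Rees k n} {m : ℕ} (hF : F * reesPow k n (Finsupp.single 0 1) ^ m ∈ reesIdeal k n) :
    F ∈ RingHom.ker (augmentation k n) := by
  rw [RingHom.mem_ker, augmentation_apply]
  by_contra h0
  rw [← reesPow_single, mul_comm, mem_reesIdeal_iff] at hF
  have h1 := reesCoeff_reesPow_mul (Finsupp.single 0 m) F 0 0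
  rw [zero_add, zero_add, Finsupp.degree_single] at h1
  obtain ⟨b, hb, hlt'⟩ := hF m (value n (Finsupp.single 0 m)) (by rwa [h1])
  have h2 := (isMaximalFactorization_iff n _).1
    (isMaximalFactorization_single_zero hpos hlt m) b hb
  rw [Finsupp.degree_single] at h2
  omega

section Quotient

/-! The quotient of the Rees algebra is handled through an arbitrary surjection `π` with kernel
`reesIdeal`, so that only the ring structure of the target is involved. -/

variable {A : Type*} [CommRing A] [Algebra k A] (π : Rees k n →ₐ[k] A)

/-- All variables but the first one are nilpotent in the tangent cone. -/
lemma isNilpotent_map_reesPow (hlt : ∀ i, i ≠ 0 → n 0 < n i)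
    (hker : ∀ F, π F = 0 ↔ F ∈ reesIdeal k n) {a : Fin (d + 1) →₀ ℕ}
    {i : Fin (d + 1)} (hi : i ≠ 0) (ha : a i ≠ 0) : IsNilpotent (π (reesPow k n a)) := by
  obtain ⟨b, rfl⟩ := exists_eq_add_single ha
  rw [reesPow_add, map_mul]
  refine Commute.isNilpotent_mul_left (Commute.all _ _) ⟨n 0, ?_⟩
  rw [← map_pow, ← reesPow_single, hker, reesPow_mem_reesIdeal_iff]
  exact not_isMaximalFactorization_single hlt hi

/-- Modulo nilpotents the tangent cone is generated by the first variable. -/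
lemma exists_polynomial_sub_mem_nilradical (hlt : ∀ i, i ≠ 0 → n 0 < n i)
    (hsurj : Function.Surjective π) (hker : ∀ F, π F = 0 ↔ F ∈ reesIdeal k n) (g : A) :
    ∃ p : Polynomial k,
      g - Polynomial.aeval (π (reesPow k n (Finsupp.single 0 1))) p ∈ nilradical A := by
  obtain ⟨F, rfl⟩ := hsurj g
  set x := π (reesPow k n (Finsupp.single 0 1)) with hx
  let L : Submodule k (Rees k n) :=
    { carrier := {F | ∃ p : Polynomial k, π F - Polynomial.aeval x p ∈ nilradical A}
      zero_mem' := ⟨0, by rw [map_zero, map_zero, sub_zero]; exact Ideal.zero_mem _⟩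
      add_mem' := by
        rintro F G ⟨p, hp⟩ ⟨q, hq⟩
        refine ⟨p + q, ?_⟩
        rw [map_add, map_add, add_sub_add_comm]
        exact Ideal.add_mem _ hp hq
      smul_mem' := by
        rintro c F ⟨p, hp⟩
        refine ⟨c • p, ?_⟩
        rw [map_smul, map_smul, ← smul_sub, Algebra.smul_def]
        exact Ideal.mul_mem_left _ _ hp }
  refine mem_of_reesMonomial_mem L F fun j a hj _ => ?_
  rcases hj.lt_or_eq with h | rfl
  · refine ⟨0, ?_⟩
    rw [map_zero, sub_zero, (hker _).2 (reesMonomial_mem_reesIdeal hj h)]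
    exact Ideal.zero_mem _
  · change ∃ p : Polynomial k, π (reesPow k n a) - Polynomial.aeval x p ∈ nilradical A
    by_cases ha : ∃ i, i ≠ 0 ∧ a i ≠ 0
    · obtain ⟨i, hi, ha⟩ := ha
      refine ⟨0, ?_⟩
      rw [map_zero, sub_zero]
      exact isNilpotent_map_reesPow π hlt hker hi ha
    · push Not at ha
      have : a = Finsupp.single 0 (a 0) := by
        ext i
        by_cases hi : i = 0
        · rw [hi, Finsupp.single_eq_same]
        · rw [ha i hi, Finsupp.single_eq_of_ne hi]
      refine ⟨Polynomial.X ^ a 0, ?_⟩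
      rw [map_pow, Polynomial.aeval_X, hx, ← map_pow, ← reesPow_single, ← this, sub_self]
      exact Ideal.zero_mem _

lemma aeval_mem_nonZeroDivisors (hsurj : Function.Surjective π)
    (hker : ∀ F, π F = 0 ↔ F ∈ reesIdeal k n) (hn : FirstPreservesMaximality n)
    (p : Polynomial k) (hp : p ≠ 0) :
    Polynomial.aeval (π (reesPow k n (Finsupp.single 0 1))) p ∈ nonZeroDivisors A := by
  rw [mem_nonZeroDivisors_iff_right]
  intro g hg
  obtain ⟨F, rfl⟩ := hsurj g
  rw [hker]
  refine mem_reesIdeal_of_aeval_mul_mem hn hp ?_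
  rw [← hker, map_mul, mul_comm, ← Polynomial.aeval_algHom_apply, hg]

lemma isCohenMacaulay_iff_firstPreservesMaximality (hpos : ∀ i, 0 < n i)
    (hlt : ∀ i, i ≠ 0 → n 0 < n i) (hsurj : Function.Surjective π)
    (hker : ∀ F, π F = 0 ↔ F ∈ reesIdeal k n) :
    IsCohenMacaulay A ↔ FirstPreservesMaximality n := by
  constructor
  · intro h
    by_contra hn
    obtain ⟨c, hc, hc'⟩ := exists_socle_factorization hlt hn
    have hmap : ∀ F, π F ∈ (RingHom.ker (augmentation k n)).map π.toRingHom ↔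
        F ∈ RingHom.ker (augmentation k n) := by
      intro F
      refine ⟨fun hF => ?_, fun hF => Ideal.mem_map_of_mem π.toRingHom hF⟩
      obtain ⟨G, hG, hGF⟩ := (Ideal.mem_map_iff_of_surjective π.toRingHom hsurj).1 hF
      have h1 : F - G ∈ RingHom.ker (augmentation k n) := by
        refine reesIdeal_le_ker_augmentation hpos ((hker _).1 ?_)
        rw [map_sub]
        exact sub_eq_zero.2 hGF.symm
      simpa using Ideal.add_mem _ h1 hG
    have hmax : (RingHom.ker (augmentation k n)).IsMaximal :=
      RingHom.ker_isMaximal_of_surjective _ augmentation_surjective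
    have hM : ((RingHom.ker (augmentation k n)).map π.toRingHom).IsMaximal := by
      rcases Ideal.map_eq_top_or_isMaximal_of_surjective π.toRingHom hsurj hmax with h | h
      · exfalso
        refine hmax.ne_top ((Ideal.eq_top_iff_one _).2 ((hmap 1).1 ?_))
        rw [h]
        exact Submodule.mem_top
      · exact h
    refine not_hasFullDepth_of_socle _ (z := π (reesPow k n c))
      (x := π (reesPow k n (Finsupp.single 0 1))) ?_ ?_ ?_ ?_
      (h.2 ((RingHom.ker (augmentation k n)).map π.toRingHom))
    · rw [Ne, hker, reesPow_mem_reesIdeal_iff, not_not]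
      exact hc
    · intro g hg
      obtain ⟨F, rfl⟩ := hsurj g
      rw [← map_mul, hker]
      exact mul_reesPow_mem_reesIdeal hc' ((hmap F).1 hg)
    · rw [hmap, RingHom.mem_ker, augmentation_apply, reesPow, reesCoeff_reesMonomial,
        Finsupp.degree_single, if_neg (fun h => one_ne_zero h.1)]
    · intro u m hu
      obtain ⟨F, rfl⟩ := hsurj u
      rw [← map_pow, ← map_mul, hker] at hu
      exact (hmap F).2 (mem_ker_augmentation_of_mul_pow_mem hpos hlt hu)
  · intro hn
    have := isNoetherianRing_rees (k := k) (n := n)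
    have : IsNoetherianRing A := isNoetherianRing_of_surjective _ _ π.toRingHom hsurj
    exact isCohenMacaulay_of_aeval_mem_nonZeroDivisors
      (exists_polynomial_sub_mem_nilradical π hlt hsurj hker)
      (aeval_mem_nonZeroDivisors π hsurj hker hn)

end Quotient

lemma isCohenMacaulay_tangentCone_iff (hpos : ∀ i, 0 < n i) (hlt : ∀ i, i ≠ 0 → n 0 < n i) :
    IsCohenMacaulay (TangentCone k n) ↔ FirstPreservesMaximality n :=
  isCohenMacaulay_iff_firstPreservesMaximality (Ideal.Quotient.mkₐ k (reesIdeal k n)) hpos hlt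
    (Ideal.Quotient.mkₐ_surjective k _) fun _ => Ideal.Quotient.eq_zero_iff_mem

end TangentCone

end NumSgp

end

theorem mainTheorem1 (k : Type*) [Field k] (d : ℕ) (n : Fin (d + 1) → ℕ)
    (hpos : ∀ i, 0 < n i) (hlt : ∀ i, i ≠ 0 → n 0 < n i) (hmin : NumSgp.IsMinimalSystem n) :
    List.TFAE [
      NumSgp.IsHomogeneousSemigroup n ∧ NumSgp.IsCohenMacaulay (NumSgp.TangentCone k n),
      ∀ a b : Fin (d + 1) →₀ ℕ,
        NumSgp.binomial k a b ∈ NumSgp.definingIdeal k n → b.degree < a.degree →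
          NumSgp.value n a ∉ NumSgp.apery (NumSgp.semigroup n) (n 0) ∧
          (a 0 + b 0 ≠ 0 → NumSgp.IsMaximalFactorization n (NumSgp.bar b) → b 0 ≤ a 0),
      ∃ E : Set (MvPolynomial (Fin (d + 1)) k),
        NumSgp.IsBinomialSet E ∧
        NumSgp.IsMinimalGeneratingSet (NumSgp.definingIdeal k n) E ∧
        NumSgp.FirstVarDividesLongerTerms E,
      ∃ E : Set (MvPolynomial (Fin (d + 1)) k),
        NumSgp.IsBinomialSet E ∧
        NumSgp.IsMinimalGeneratingSet (NumSgp.definingIdeal k n) E ∧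
        NumSgp.IsStandardBasis (NumSgp.definingIdeal k n) E ∧
        NumSgp.FirstVarDividesLongerTerms E,
      ∃ G : Set (MvPolynomial (Fin (d + 1)) k),
        NumSgp.IsBinomialSet G ∧
        NumSgp.IsMinimalGroebnerBasis (NumSgp.definingIdeal k n) G ∧
        (∀ f ∈ G, (¬ ∃ m, f.IsHomogeneous m) → 0 ∈ f.vars) ∧
        (∀ f ∈ G, ∀ c, NumSgp.IsLeadingExponent f c → c 0 = 0)] := by
  open NumSgp in
  rw [isHomogeneousSemigroup_iff hpos, isCohenMacaulay_tangentCone_iff hpos hlt,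
    pair_condition_iff]
  tfae_have 1 ↔ 2 := Iff.rfl
  tfae_have 4 → 3 := fun ⟨E, hB, hE, _, hF⟩ => ⟨E, hB, hE, hF⟩
  tfae_have 3 → 1 := by
    rintro ⟨E, hB, hE, hF⟩
    have hI : E ⊆ (definingIdeal k n : Set (MvPolynomial (Fin (d + 1)) k)) := by
      rw [← hE.1]
      exact Ideal.subset_span
    have hc := connects_of_span_eq hB hE.1
    exact ⟨lengthsForceFirst_of_connects hI hF hc, firstPreservesMaximality_of_connects hI hF hc⟩
  tfae_have 1 → 5 := fun ⟨hh, hn⟩ => ⟨reducedBasis k n, isBinomialSet_reducedBasis,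
    isMinimalGroebnerBasis_reducedBasis hpos, zero_mem_vars_reducedBasis hpos hh hn,
    leading_first_eq_zero_reducedBasis hn⟩
  tfae_have 5 → 1 := by
    rintro ⟨G, hB, hG, hvars, hlead⟩
    have hc := hG.1.connects hpos hB
    have hF := firstVarDividesLongerTerms_of_leading hvars hlead
    exact ⟨lengthsForceFirst_of_connects hG.1.1 hF hc,
      firstPreservesMaximality_of_connects hG.1.1 hF hc⟩
  tfae_have 1 → 4 := by
    rintro ⟨hh, hn⟩
    -- any minimal generating subset of the reduced Groebner basis will do
    have hspan : Ideal.span (reducedBasis k n) = definingIdeal k n :=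
      span_eq_of_connects reducedBasis_subset
        ((isGroebnerBasis_reducedBasis hpos).connects hpos isBinomialSet_reducedBasis)
    obtain ⟨E, hsub, hE⟩ := exists_minimal_generating_subset (B := reducedBasis k n)
    rw [hspan] at hE
    have hB : IsBinomialSet E := fun f hf => isBinomialSet_reducedBasis f (hsub hf)
    have hF : FirstVarDividesLongerTerms E := fun a b hab =>
      firstVarDividesLongerTerms_of_leading (zero_mem_vars_reducedBasis hpos hh hn)
        (leading_first_eq_zero_reducedBasis hn) a b (hab.imp (@hsub _) (@hsub _))
    exact ⟨E, hB, hE, isStandardBasis_of_span_eq hpos hB hE.1 hF, hF⟩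
  tfae_finish
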